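/- Let $\mathrm{Imm}=\{c\in C^\infty(S^1,\mathbb R^3): c'(\theta)\neq 0 \text{ for all } \theta\}$, $S^1=\mathbb R/2\pi\mathbb Z$, with tangent spaces $T_c\mathrm{Imm}=C^\infty(S^1,\mathbb R^3)$, and let $B_i(S^1,\mathbb R^3)=\mathrm{Imm}/\mathrm{Diff}^+(S^1)$, with projection $\pi$. The vertical space at $c$ is $\{a\,c' : a\in C^\infty(S^1)\}$, and the tangent space of $B_i$ at $\pi(c)$ is the quotient of $T_c\mathrm{Imm}$ by it. Write $D_s=|c'|^{-1}\partial_\theta$, $ds=|c'|\,d\theta$, $\ell(c)=\int_{S^1}ds$. For a field of operators $L_c$ on $C^\infty(S^1,\mathbb R^3)$ put $$\Theta^L_c(h)=\int_{S^1}\langle c\times D_sc,\,L_ch\rangle\,ds,\qquad \Omega^L=-d\Theta^L ,\qquad \Omega^{\mathrm{MW}}_c(h,k)=\int_{S^1}\langle D_sc\times h,\,k\rangle\,ds ,$$ the last being the Marsden–Weinstein form; let $I_c=c$ be the scaling vector field, and let $D_{c,h}$ denote the directional derivative at $c$ in direction $h$. Smoothness is that of convenient calculus: smooth finite-dimensional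 families of curves are mapped to smooth families. A two-form induces a two-form on a quotient if it is invariant under $\mathrm{Diff}^+(S^1)$, annihilates the tangent spaces of the fibres, and has vanishing Lie derivative along the distribution that is divided out. Non-degenerate means weakly non-degenerate: the map from each tangent space to its dual is injective. **Theorem.** Let $\lambda:\mathrm{Imm}\to\mathbb R_{>0}$ be smooth and $\mathrm{Diff}^+(S^1)$-invariant, and let $\Theta^\lambda,\Omega^\lambda$ be the forms given by $L_c=\lambda(c)\,\mathrm{id}$. Then $\Theta^\lambda$ and $\Omega^\lambda$ are smooth, $\Omega^\lambda$ is closed, and $$\Omega^\lambda=\lambda\,\Omega^{\mathrm{id}}+\Theta^{\mathrm{id}}\wedge d\lambda .$$ (a) $\Omega^\lambda$ induces a two-form $\bar\Omega^\lambda$ on $B_i(S^1,\mathbb R^3)$, which is non-degenerate at $\pi(c)$ for every $c$ with $3\lambda(c)+D_{c,c}\lambda\neq0$. In particular it is weakly symplectic on $B_i(S^1,\mathbb R^3)$ if $3\lambda+D_{c,c}\lambda$ vanishes nowhere. If $3\lambda+D_{c,c}\lambda$ does not vanish identically on any non-empty open subset of $\mathrm{Imm}$, then $\bar\Omega^\lambda$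 is non-degenerate over an open dense set, and every smooth vector field $Y$ on $\mathrm{Imm}$ with $\Omega^\lambda(Y,\cdot)=0$ is vertical. (b) Assume that $3\lambda(c)+D_{c,c}\lambda=0$ for all $c\in\mathrm{Imm}$, and that $X=\mathrm{hgrad}^{\Omega^{\mathrm{id}}}\lambda$ exists and is smooth, that is, $X$ is a smooth vector field on $\mathrm{Imm}$ with $\Omega^{\mathrm{id}}(X,\cdot)=d\lambda$ and $\int_{S^1}\langle X_c,a\,c'\rangle ds=0$ for all $c\in\mathrm{Imm}$ and $a\in C^\infty(S^1)$. Then $I$ and $X$ lie in the kernel of $\Omega^\lambda$, are linearly independent modulo the vertical space at every $c$, and span an involutive distribution $\mathcal F$. Let $\mathrm{Imm}/(\mathrm{Diff}^+(S^1)\times\mathcal F)$ be the quotient by reparametrizations and by smooth paths tangent to $\mathcal F$, and define the quotients of the level sets below likewise, with quotient smooth structures (a family is smooth if it lifts locally to a smooth family of curves). Let $\bar X$ be the field induced by $X$ on $B_i$. * $\Omega^\lambda$ induces a non-degenerate two-form on $\mathrm{Imm}/(\mathrm{Diff}^+(S^1)\times\mathcal F)$. * The inclusion induces a diffeomorphism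 from $\{\bar c\in B_i:\bar\lambda(\bar c)=1\}/\mathrm{span}(\bar X)$ onto $\mathrm{Imm}/(\mathrm{Diff}^+(S^1)\times\mathcal F)$, which is an isomorphism on tangent spaces. The form induced by $\Omega^\lambda$ on $\{\bar\lambda=1\}/\mathrm{span}(\bar X)$ is non-degenerate, and is given by $3\,\Omega^{\mathrm{MW}}$. * Let $X^\ell=X-\frac{d\ell(X)}{\ell}\,I$ be the projection of $X$ along the scaling direction to the level sets of $\ell$ (so $X^\ell=X$ where $X$ is tangent to them). The inclusion induces in the same way a diffeomorphism from $\{\bar c\in B_i:\bar\ell(\bar c)=1\}/\mathrm{span}(\bar X^\ell)$ onto $\mathrm{Imm}/(\mathrm{Diff}^+(S^1)\times\mathcal F)$, and the form induced by $\Omega^\lambda$ on the former is non-degenerate. -/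

import Mathlib

open scoped ContDiff

noncomputable section

namespace SpaceCurve

/-! ## Curves, immersions, reparametrizations -/

/-- Euclidean three-space. -/
abbrev E3 : Type := EuclideanSpace ℝ (Fin 3)

/-- The vector cross product of Euclidean three-space. -/
def cross (u v : E3) : E3 :=
  WithLp.toLp 2 (crossProduct (WithLp.ofLp u) (WithLp.ofLp v))

/-- The vector space of smooth maps from the circle `S¹ = ℝ / 2πℤ` to `ℝ³`,
realized as smooth `2π`-periodic functions of the angle. -/
def loopSubmodule : Submodule ℝ (ℝ → E3) where
  carrier := {c | ContDiff ℝ ∞ c ∧ Function.Periodic c (2 * Real.pi)}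
  add_mem' := fun ha hb => ⟨ha.1.add hb.1, ha.2.add hb.2⟩
  zero_mem' := ⟨contDiff_const, fun _ => rfl⟩
  smul_mem' := fun r _ hc => ⟨hc.1.const_smul r, hc.2.smul r⟩

/-- `C^∞(S¹, ℝ³)`. It is also the tangent space of the space of immersions at every immersion. -/
abbrev Loop : Type := ↥loopSubmodule

instance instAddCommGroupLoop : AddCommGroup Loop := Submodule.addCommGroup loopSubmodule

/-- The space `Imm(S¹, ℝ³)` of immersed closed space curves. -/
def Imm : Set Loop := {c | ∀ θ : ℝ, deriv c.1 θ ≠ 0}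

open Classical in
/-- A function regarded as an element of `C^∞(S¹, ℝ³)` (and `0` if it is not one). -/
def toLoop (f : ℝ → E3) : Loop := if hf : f ∈ loopSubmodule then ⟨f, hf⟩ else 0

/-- Orientation preserving diffeomorphisms of the circle, given by their lifts to `ℝ`. -/
structure DiffPlus where
  /-- the lift -/
  lift : ℝ → ℝ
  smooth : ContDiff ℝ ∞ lift
  deriv_pos : ∀ θ : ℝ, 0 < deriv lift θ
  degree_one : ∀ θ : ℝ, lift (θ + 2 * Real.pi) = lift θ + 2 * Real.pi

/-- The right action `c ↦ c ∘ φ` of `Diff⁺(S¹)` on loops. -/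
def reparam (φ : DiffPlus) (c : Loop) : Loop :=
  ⟨fun θ => c.1 (φ.lift θ), c.2.1.comp φ.smooth, fun θ => by
    show c.1 (φ.lift (θ + 2 * Real.pi)) = c.1 (φ.lift θ)
    rw [φ.degree_one]
    exact c.2.2 _⟩

/-- The vertical space at `c`: the fields `a • c'` along `c`, where `a ∈ C^∞(S¹)`.
It is the tangent space of the `Diff⁺(S¹)`-orbit through `c`. -/
def vert (c : Loop) : Submodule ℝ Loop where
  carrier := {h | ∃ a : ℝ → ℝ, ContDiff ℝ ∞ a ∧ Function.Periodic a (2 * Real.pi) ∧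
    ∀ θ : ℝ, h.1 θ = a θ • deriv c.1 θ}
  add_mem' := by
    rintro h k ⟨a, ha, pa, ea⟩ ⟨b, hb, pb, eb⟩
    refine ⟨fun θ => a θ + b θ, ha.add hb, pa.add pb, fun θ => ?_⟩
    show h.1 θ + k.1 θ = _
    rw [ea, eb, add_smul]
  zero_mem' := ⟨fun _ => 0, contDiff_const, fun _ => rfl, fun θ => by simp⟩
  smul_mem' := by
    rintro r h ⟨a, ha, pa, ea⟩
    refine ⟨fun θ => r * a θ, contDiff_const.mul ha, fun θ => by simp [pa θ], fun θ => ?_⟩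
    show r • h.1 θ = _
    rw [ea, smul_smul]

/-- The length of a curve. -/
def length (c : Loop) : ℝ := ∫ θ in (0 : ℝ)..(2 * Real.pi), ‖deriv c.1 θ‖

/-- The arclength derivative `D_s f = f' / |c'|` along `c`. -/
def arcDeriv (c : Loop) (f : ℝ → E3) (θ : ℝ) : E3 := ‖deriv c.1 θ‖⁻¹ • deriv f θ

/-! ## Calculus on spaces of curves

Smoothness is the smoothness of convenient calculus. A smooth family of loops is one that is
jointly smooth in the parameter and the angle; a map is smooth if it maps smooth families to smooth
families. -/

/-- A family of loops, parametrized by the open set `U`, is smooth. -/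
def IsPlot {P : Type*} [NormedAddCommGroup P] [NormedSpace ℝ P] (U : Set P) (γ : P → Loop) : Prop :=
  IsOpen U ∧ ContDiffOn ℝ ∞ (fun p : P × ℝ => (γ p.1).1 p.2) (U ×ˢ Set.univ)

/-- A smooth finite-dimensional family, parametrized by `U ⊆ ℝⁿ`, of elements of `M`. -/
def IsPlotIn (M : Set Loop) {n : ℕ} (U : Set (EuclideanSpace ℝ (Fin n)))
    (γ : EuclideanSpace ℝ (Fin n) → Loop) : Prop :=
  IsPlot U γ ∧ ∀ x ∈ U, γ x ∈ M

/-- A smooth real function on the space of immersions. Its values off `Imm` play no role. -/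
def IsSmoothFun (f : Loop → ℝ) : Prop :=
  ∀ (n : ℕ) (U : Set (EuclideanSpace ℝ (Fin n))) (γ : EuclideanSpace ℝ (Fin n) → Loop),
    IsPlotIn Imm U γ → ContDiffOn ℝ ∞ (fun x => f (γ x)) U

/-- A smooth vector field on the space of immersions. -/
def IsSmoothField (Y : Loop → Loop) : Prop :=
  ∀ (n : ℕ) (U : Set (EuclideanSpace ℝ (Fin n))) (γ : EuclideanSpace ℝ (Fin n) → Loop),
    IsPlotIn Imm U γ → IsPlot U (fun x => Y (γ x))

/-- A (fibrewise linear) one-form on the space of immersions is smooth. -/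
def IsSmoothOneForm (α : Loop → Loop → ℝ) : Prop :=
  (∀ c ∈ Imm, IsLinearMap ℝ (α c)) ∧
  ∀ (n : ℕ) (U : Set (EuclideanSpace ℝ (Fin n))) (γ h : EuclideanSpace ℝ (Fin n) → Loop),
    IsPlotIn Imm U γ → IsPlot U h → ContDiffOn ℝ ∞ (fun x => α (γ x) (h x)) U

/-- A smooth two-form on the space of immersions: fibrewise bilinear and alternating, and smooth. -/
def IsSmoothTwoForm (Ω : Loop → Loop → Loop → ℝ) : Prop :=
  (∀ c ∈ Imm, (∀ k, IsLinearMap ℝ (fun h => Ω c h k)) ∧ (∀ h, IsLinearMap ℝ (Ω c h)) ∧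
    ∀ h, Ω c h h = 0) ∧
  ∀ (n : ℕ) (U : Set (EuclideanSpace ℝ (Fin n))) (γ h k : EuclideanSpace ℝ (Fin n) → Loop),
    IsPlotIn Imm U γ → IsPlot U h → IsPlot U k →
      ContDiffOn ℝ ∞ (fun x => Ω (γ x) (h x) (k x)) U

/-- Open subsets of `Imm`, for the final topology with respect to all smooth families; this is the
`c^∞`-topology, which on the Fréchet space `C^∞(S¹, ℝ³)` is the usual `C^∞`-topology. -/
def IsOpenInImm (V : Set Loop) : Prop :=
  V ⊆ Imm ∧
  ∀ (n : ℕ) (U : Set (EuclideanSpace ℝ (Fin n))) (γ : EuclideanSpace ℝ (Fin n) → Loop),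
    IsPlotIn Imm U γ → IsOpen (U ∩ γ ⁻¹' V)

/-- The directional derivative `D_{c,h} f` of a function. -/
def dirDeriv (f : Loop → ℝ) (c h : Loop) : ℝ := deriv (fun t : ℝ => f (c + t • h)) 0

/-- The directional derivative `D_{c,h} Y` of a vector field. -/
def fieldDeriv (Y : Loop → Loop) (c h : Loop) : Loop :=
  toLoop (fun θ => deriv (fun t : ℝ => (Y (c + t • h)).1 θ) 0)

/-- The Lie bracket `[Y, Z] = D_Y Z - D_Z Y`. -/
def bracket (Y Z : Loop → Loop) (c : Loop) : Loop := fieldDeriv Z c (Y c) - fieldDeriv Y c (Z c)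

/-- The exterior derivative of a one-form, evaluated on constant vector fields. -/
def dOne (α : Loop → Loop → ℝ) (c h k : Loop) : ℝ :=
  dirDeriv (fun b => α b k) c h - dirDeriv (fun b => α b h) c k

/-- The exterior derivative of a two-form, evaluated on constant vector fields. -/
def dTwo (Ω : Loop → Loop → Loop → ℝ) (c h k l : Loop) : ℝ :=
  dirDeriv (fun b => Ω b k l) c h - dirDeriv (fun b => Ω b h l) c k + dirDeriv (fun b => Ω b h k) c l

/-- A closed two-form on the space of immersions. -/
def IsClosedTwoForm (Ω : Loop → Loop → Loop → ℝ) : Prop :=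
  ∀ c ∈ Imm, ∀ h k l : Loop, dTwo Ω c h k l = 0

/-- The wedge product of two one-forms. -/
def wedge (α β : Loop → Loop → ℝ) (c h k : Loop) : ℝ := α c h * β c k - α c k * β c h

/-- The Lie derivative `(𝓛_Y Ω)(h, k)` of a two-form, for constant fields `h`, `k`, for which
`[Y, h] = - D_h Y`. -/
def lieDeriv (Y : Loop → Loop) (Ω : Loop → Loop → Loop → ℝ) (c h k : Loop) : ℝ :=
  dirDeriv (fun b => Ω b h k) c (Y c) + Ω c (fieldDeriv Y c h) k + Ω c h (fieldDeriv Y c k)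

/-- `h` is the velocity at time `t` of the curve `γ` in the space of loops. -/
def IsVelocity (γ : ℝ → Loop) (t : ℝ) (h : Loop) : Prop :=
  ∀ θ : ℝ, HasDerivAt (fun s => (γ s).1 θ) (h.1 θ) t

/-! ## Metrics, Liouville forms and the induced two-forms -/

/-- The metric `G^L_c(h, k) = ∫ ⟨L_c h, k⟩ ds`. -/
def metric (L : Loop → Loop →ₗ[ℝ] Loop) (c h k : Loop) : ℝ :=
  ∫ θ in (0 : ℝ)..(2 * Real.pi), inner ℝ ((L c h).1 θ) (k.1 θ) * ‖deriv c.1 θ‖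

/-- The Liouville form `Θ^L_c(h) = ∫ ⟨c × D_s c, L_c h⟩ ds`. -/
def liouville (L : Loop → Loop →ₗ[ℝ] Loop) (c h : Loop) : ℝ :=
  ∫ θ in (0 : ℝ)..(2 * Real.pi),
    inner ℝ (cross (c.1 θ) (arcDeriv c c.1 θ)) ((L c h).1 θ) * ‖deriv c.1 θ‖

/-- The induced two-form `Ω^L = - dΘ^L`. -/
def inducedForm (L : Loop → Loop →ₗ[ℝ] Loop) (c h k : Loop) : ℝ := - dOne (liouville L) c h k

/-- The conformal inertia operator `L_c = lam(c) · id`. -/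
def conformal (lam : Loop → ℝ) (c : Loop) : Loop →ₗ[ℝ] Loop := lam c • LinearMap.id

/-- The inertia operator `L = id`. -/
def idOp (_c : Loop) : Loop →ₗ[ℝ] Loop := LinearMap.id

/-- The Marsden-Weinstein form `Ω^MW_c(h, k) = ∫ ⟨D_s c × h, k⟩ ds`. -/
def marsdenWeinstein (c h k : Loop) : ℝ :=
  ∫ θ in (0 : ℝ)..(2 * Real.pi),
    inner ℝ (cross (arcDeriv c c.1 θ) (h.1 θ)) (k.1 θ) * ‖deriv c.1 θ‖

/-- `X` is the horizontal gradient of `f` with respect to `Ω^id`: one has `df = Ω^id(X, ·)`, and `X`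
is `G^id`-orthogonal to the `Diff⁺(S¹)`-orbits. -/
def IsHorizontalGradient (f : Loop → ℝ) (X : Loop → Loop) : Prop :=
  ∀ c ∈ Imm, (∀ k : Loop, dirDeriv f c k = inducedForm idOp c (X c) k) ∧
    ∀ h ∈ vert c, metric idOp c (X c) h = 0

/-! ## Quotients of spaces of curves, and forms on them

Below, `M` is one of the spaces `Imm`, `{lam = 1}`, `{length = 1}`, and `D` is a distribution on it.
The quotient of `M` by `Diff⁺(S¹)` and by the leaves of `D` is considered. -/

/-- One step of the equivalence relation: reparametrize, or move along a smooth path in `M` which is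
everywhere tangent to `D`. -/
def leafStep (M : Set Loop) (D : Loop → Submodule ℝ Loop) (b c : M) : Prop :=
  (∃ φ : DiffPlus, c.1 = reparam φ b.1) ∨
  ∃ γ : ℝ → Loop, IsPlot Set.univ γ ∧ (∀ t, γ t ∈ M) ∧
    (∀ t, ∃ h ∈ D (γ t), IsVelocity γ t h) ∧ γ 0 = b.1 ∧ γ 1 = c.1

/-- The quotient `M / (Diff⁺(S¹) × D)`: the leaf space of the distribution induced by `D` on
`M / Diff⁺(S¹)`. -/
def LeafSpace (M : Set Loop) (D : Loop → Submodule ℝ Loop) : Type := Quot (leafStep M D)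

/-- The zero distribution. The quotient `LeafSpace Imm noDist` is the shape space `B_i(S¹, ℝ³)`. -/
def noDist (_c : Loop) : Submodule ℝ Loop := ⊥

/-- The smooth families in a leaf space: those which locally lift to smooth families in `M`. -/
def IsQuotPlot (M : Set Loop) (D : Loop → Submodule ℝ Loop) {n : ℕ}
    (U : Set (EuclideanSpace ℝ (Fin n))) (p : EuclideanSpace ℝ (Fin n) → LeafSpace M D) : Prop :=
  IsOpen U ∧ ∀ x ∈ U, ∃ (V : Set (EuclideanSpace ℝ (Fin n)))
    (γ : EuclideanSpace ℝ (Fin n) → Loop) (hγ : IsPlotIn M V γ), x ∈ V ∧ V ⊆ U ∧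
      ∀ (y : EuclideanSpace ℝ (Fin n)) (hy : y ∈ V), p y = Quot.mk _ ⟨γ y, hγ.2 y hy⟩

/-- A map between leaf spaces is smooth if it maps smooth families to smooth families. -/
def IsSmoothQuotMap {M M' : Set Loop} {D D' : Loop → Submodule ℝ Loop}
    (f : LeafSpace M D → LeafSpace M' D') : Prop :=
  ∀ (n : ℕ) (U : Set (EuclideanSpace ℝ (Fin n))) (p : EuclideanSpace ℝ (Fin n) → LeafSpace M D),
    IsQuotPlot M D U p → IsQuotPlot M' D' U (fun x => f (p x))

/-- The tangent space `T_c M`, spanned by the velocities of the smooth curves in `M` through `c`. -/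
def tangentSpace (M : Set Loop) (c : Loop) : Submodule ℝ Loop :=
  Submodule.span ℝ {h | ∃ (γ : ℝ → Loop) (ε : ℝ), 0 < ε ∧ IsPlot (Set.Ioo (-ε) ε) γ ∧
    (∀ t ∈ Set.Ioo (-ε) ε, γ t ∈ M) ∧ γ 0 = c ∧ IsVelocity γ 0 h}

/-- The tangent space at `c` of the fibre of `M → M / (Diff⁺(S¹) × D)`. -/
def fibreTangent (D : Loop → Submodule ℝ Loop) (c : Loop) : Submodule ℝ Loop := vert c ⊔ D c

/-- The tangent space of `M / (Diff⁺(S¹) × D)` at the class of `c`. -/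
abbrev QuotTangent (M : Set Loop) (D : Loop → Submodule ℝ Loop) (c : Loop) : Type :=
  ↥(tangentSpace M c) ⧸ (fibreTangent D c).submoduleOf (tangentSpace M c)

/-- The class in the tangent space of the quotient of a tangent vector of `M`. -/
def tangentClass (M : Set Loop) (D : Loop → Submodule ℝ Loop) (c : Loop) (h : tangentSpace M c) :
    QuotTangent M D c :=
  Submodule.Quotient.mk h

/-- A two-form on the quotient `M / (Diff⁺(S¹) × D)`, as a family of alternating bilinear forms on
the tangent spaces of the quotient which does not depend on the parametrization of the curves. -/
structure QuotientForm (M : Set Loop) (D : Loop → Submodule ℝ Loop) where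
  /-- the fibres of the projection are tangent to `M` -/
  fibre_le : ∀ c : M, fibreTangent D c.1 ≤ tangentSpace M c.1
  /-- the bilinear form on the tangent space of the quotient at the class of `c` -/
  form : ∀ c : M, QuotTangent M D c.1 →ₗ[ℝ] QuotTangent M D c.1 →ₗ[ℝ] ℝ
  alternating : ∀ (c : M) (u : QuotTangent M D c.1), form c u u = 0
  invariant : ∀ (φ : DiffPlus) (b c : M) (h k : tangentSpace M b.1) (h₁ k₁ : tangentSpace M c.1),
    c.1 = reparam φ b.1 → h₁.1 = reparam φ h.1 → k₁.1 = reparam φ k.1 →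
      form c (tangentClass M D c.1 h₁) (tangentClass M D c.1 k₁) =
        form b (tangentClass M D b.1 h) (tangentClass M D b.1 k)

/-- The two-form `Ω` on the space of immersions induces the form `η` on the quotient of `M`: the
pullback of `η` to `M` is the restriction of `Ω`, and this restriction is constant along the leaves of
`D`, in that its Lie derivatives along sections of `D` vanish. -/
def Induces {M : Set Loop} {D : Loop → Submodule ℝ Loop} (Ω : Loop → Loop → Loop → ℝ)
    (η : QuotientForm M D) : Prop :=
  (∀ (c : M) (h k : tangentSpace M c.1),
    η.form c (tangentClass M D c.1 h) (tangentClass M D c.1 k) = Ω c.1 h.1 k.1) ∧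
  ∀ Y : Loop → Loop, IsSmoothField Y → (∀ c ∈ Imm, Y c ∈ D c) →
    ∀ c ∈ M, ∀ h ∈ tangentSpace M c, ∀ k ∈ tangentSpace M c, lieDeriv Y Ω c h k = 0

/-- Weak non-degeneracy at (the class of) `c`: the map from the tangent space of the quotient to its
dual is injective. -/
def QuotientForm.NondegenerateAt {M : Set Loop} {D : Loop → Submodule ℝ Loop}
    (η : QuotientForm M D) (c : M) : Prop :=
  Function.Injective (η.form c)

/-- For `M ⊆ M'`, the inclusion induces a diffeomorphism from `M / (Diff⁺(S¹) × D)` onto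
`M' / (Diff⁺(S¹) × D')`, and isomorphisms of the tangent spaces of these quotients. -/
def InclusionIdentifies (M : Set Loop) (D : Loop → Submodule ℝ Loop)
    (M' : Set Loop) (D' : Loop → Submodule ℝ Loop) : Prop :=
  ∃ hM : M ⊆ M',
    (∃ e : LeafSpace M D ≃ LeafSpace M' D', IsSmoothQuotMap e ∧ IsSmoothQuotMap e.symm ∧
      ∀ c : M, e (Quot.mk _ c) = Quot.mk _ ⟨c.1, hM c.2⟩) ∧
    ∀ c ∈ M, tangentSpace M c ⊔ fibreTangent D' c = tangentSpace M' c ∧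
      tangentSpace M c ⊓ fibreTangent D' c = fibreTangent D c

/-! ## The objects of the scale-invariant case -/

/-- The function `3 lam(c) + D_{c,c} lam`. -/
def scaleDefect (lam : Loop → ℝ) (c : Loop) : ℝ := 3 * lam c + dirDeriv lam c c

/-- The scaling vector field `I_c = c`. -/
def scalingField (c : Loop) : Loop := c

/-- The distribution `𝓕` spanned by the scaling field and `X`. -/
def scalingDist (X : Loop → Loop) (c : Loop) : Submodule ℝ Loop :=
  Submodule.span ℝ {scalingField c, X c}

/-- The distribution spanned by `X`. -/
def lineDist (X : Loop → Loop) (c : Loop) : Submodule ℝ Loop := Submodule.span ℝ {X c}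

/-- The projection of a vector field along the scaling field to the level sets of the length. -/
def lengthProj (X : Loop → Loop) (c : Loop) : Loop :=
  X c - (dirDeriv length c (X c) / length c) • scalingField c

/-- The level set `{f = 1}` in the space of immersions. -/
def levelOne (f : Loop → ℝ) : Set Loop := {c | c ∈ Imm ∧ f c = 1}

end SpaceCurve

end

open SpaceCurve

/-! Write T(u,v,w) for the integral of det(u,v,w) over the circle (`tripleInt`). The factor |c'| of
ds cancels the one in D_s, so Θ^id_c(h) = T(c,c',h) = T(c',h,c) is polynomial in c, and integration
by parts gives Ω^id = 3 T(c',·,·), three times the Marsden–Weinstein form (`inducedForm_id`). The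
product rule then yields Ω^λ(h,k) = 3λ T(c',h,k) + T(c',h,c) dλ(k) - T(c',k,c) dλ(h)
(`inducedForm_conformal`). The rest is mostly linear algebra with this formula, because T(c',v,·) =
0 means c' × v = 0, that is, v is vertical.

Contraction with the scaling field gives Ω^λ(h,c) = (3λ + dλ(c)) T(c',h,c). If the factor is
nonzero, a kernel vector h has T(c',h,c) = 0, so 3λh + dλ(h)c is vertical. Since dλ kills vertical
vectors, applying it gives dλ(h) = 0, and h itself is vertical (`mem_vert_of_inducedForm_eq_zero`).
For kernel fields, verticality passes from a dense set to all curves by continuity.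

If the factor vanishes identically, Euler's identity makes λ homogeneous of degree -3. With dλ = 3
T(c',X,·), the same formula shows that the kernel is exactly the vertical space plus the span of I
and X (`mem_fibreTangent_iff`). Comparing degrees in the gradient equation, X has degree -5
(`field_exp_smul`), so [I,X] = -6X. For a positive invariant function f of degree m ≠ 0, the map c ↦
f(c)^(-1/m) c retracts Imm onto {f = 1} along scaling orbits and carries the distribution to the
line spanned by the projection of X; hence {f = 1} is a global slice
(`IsHomogeneousFun.inclusionIdentifies`). This is used for λ and for the length. Non-degeneracy
passes to the slices because I lies in the kernel.

Invariance along the leaves is Cartan's formula: Ω^λ is closed and the sections of the distribution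
lie in its kernel. Smoothness is tested only on finite-dimensional families; Hadamard's lemma
(`IsPlot.exists_eq_add_smul`) then provides the chain and Leibniz rules. -/

section ParametricIntegral

/-! ### Smooth dependence of integrals on parameters. -/

open Set Filter Topology

universe u

variable {E : Type u} [NormedAddCommGroup E] [NormedSpace ℝ E]

/-- Differentiation under the integral sign over a compact interval, for an integrand which is
continuously differentiable near the domain of integration. -/
theorem hasFDerivAt_intervalIntegral_of_contDiffOn {G : Type u} [NormedAddCommGroup G]
    [NormedSpace ℝ G] {W : Set (E × ℝ)} (hW : IsOpen W) {V : Set E} (hV : IsOpen V) {a b : ℝ}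
    (hab : a ≤ b) (hVW : V ×ˢ Icc a b ⊆ W) {F : E × ℝ → G} (hF : ContDiffOn ℝ 1 F W) {x₀ : E}
    (hx₀ : x₀ ∈ V) :
    HasFDerivAt (fun x => ∫ t in a..b, F (x, t))
      (∫ t in a..b, (fderiv ℝ F (x₀, t)).comp (ContinuousLinearMap.inl ℝ E ℝ)) x₀ := by
  have hdiff : ∀ z ∈ W, DifferentiableAt ℝ F z := fun z hz =>
    (hF.differentiableOn one_ne_zero).differentiableAt (hW.mem_nhds hz)
  have hcont : ContinuousOn (fun z => (fderiv ℝ F z).comp (ContinuousLinearMap.inl ℝ E ℝ)) W :=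
    (hF.continuousOn_fderiv_of_isOpen hW le_rfl).clm_comp continuousOn_const
  have slice : ∀ x ∈ V, ∀ {H : Type u} [NormedAddCommGroup H] {f : E × ℝ → H},
      ContinuousOn f W → ContinuousOn (fun t => f (x, t)) (Icc a b) := by
    intro x hx H _ f hf
    exact hf.comp (by fun_prop) fun t ht => hVW ⟨hx, ht⟩
  have meas : ∀ x ∈ V, ∀ {H : Type u} [NormedAddCommGroup H] {f : E × ℝ → H},
      ContinuousOn f W → MeasureTheory.AEStronglyMeasurable (fun t => f (x, t))
        (MeasureTheory.volume.restrict (uIoc a b)) := by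
    intro x hx H _ f hf
    rw [uIoc_of_le hab]
    exact ((slice x hx hf).aestronglyMeasurable measurableSet_Icc).mono_measure
      (MeasureTheory.Measure.restrict_mono Ioc_subset_Icc_self le_rfl)
  obtain ⟨C, hC⟩ := isCompact_Icc.exists_bound_of_continuousOn (slice x₀ hx₀ hcont)
  -- Compactness of [a, b] makes the bound at x₀, relaxed from C to C + 1, valid on one
  -- neighbourhood for all t; this is the dominating constant.
  have hev : ∀ᶠ x in 𝓝 x₀, ∀ t ∈ Icc a b,
      ‖(fderiv ℝ F (x, t)).comp (ContinuousLinearMap.inl ℝ E ℝ)‖ < C + 1 := by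
    refine isCompact_Icc.eventually_forall_of_forall_eventually fun t ht => ?_
    have hz : (x₀, t) ∈ W := hVW ⟨hx₀, ht⟩
    exact (hcont.continuousAt (hW.mem_nhds hz)).norm.eventually_lt continuousAt_const
      ((hC t ht).trans_lt (lt_add_one C))
  have hmem : ∀ t, t ∈ uIoc a b → t ∈ Icc a b := fun t ht => by
    rw [uIoc_of_le hab] at ht
    exact Ioc_subset_Icc_self ht
  refine intervalIntegral.hasFDerivAt_integral_of_dominated_of_fderiv_le
    (F := fun x t => F (x, t))
    (F' := fun x t => (fderiv ℝ F (x, t)).comp (ContinuousLinearMap.inl ℝ E ℝ))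
    (bound := fun _ => C + 1) (hev.and (hV.mem_nhds hx₀)) ?_ ?_ (meas x₀ hx₀ hcont) ?_ ?_ ?_
  · filter_upwards [hV.mem_nhds hx₀] with x hx using meas x hx hF.continuousOn
  · exact ContinuousOn.intervalIntegrable_of_Icc hab (slice x₀ hx₀ hF.continuousOn)
  · exact MeasureTheory.ae_of_all _ fun t ht x hx => (hx.1 t (hmem t ht)).le
  · exact intervalIntegrable_const
  · refine MeasureTheory.ae_of_all _ fun t ht x hx => ?_
    have := (hdiff (x, t) (hVW ⟨hx.2, hmem t ht⟩)).hasFDerivAt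
    exact this.comp x (hasFDerivAt_prodMk_left x t)

/-- The derivative of the integral is again such an integral, with values in `E →L[ℝ] G`. The
induction on n therefore quantifies over the target, which is why E and G share a universe. -/
theorem contDiffOn_nat_intervalIntegral (n : ℕ) : ∀ {G : Type u} [NormedAddCommGroup G]
    [NormedSpace ℝ G] {W : Set (E × ℝ)} (_ : IsOpen W) {V : Set E} (_ : IsOpen V) {a b : ℝ}
    (_ : a ≤ b) (_ : V ×ˢ Icc a b ⊆ W) {F : E × ℝ → G} (_ : ContDiffOn ℝ ∞ F W),
    ContDiffOn ℝ n (fun x => ∫ t in a..b, F (x, t)) V := by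
  induction n with
  | zero =>
    intro G _ _ W hW V hV a b hab hVW F hF
    exact contDiffOn_zero.2 fun x hx => (hasFDerivAt_intervalIntegral_of_contDiffOn hW hV hab hVW
      (hF.of_le (by exact_mod_cast le_top)) hx).continuousAt.continuousWithinAt
  | succ n ih =>
    intro G _ _ W hW V hV a b hab hVW F hF
    have hd := fun x hx => hasFDerivAt_intervalIntegral_of_contDiffOn (x₀ := x) hW hV hab hVW
      (hF.of_le (by exact_mod_cast le_top)) hx
    push_cast
    rw [contDiffOn_succ_iff_fderiv_of_isOpen hV]
    refine ⟨fun x hx => (hd x hx).differentiableAt.differentiableWithinAt, by simp, ?_⟩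
    refine (ih hW hV hab hVW (F := fun z => (fderiv ℝ F z).comp
      (ContinuousLinearMap.inl ℝ E ℝ)) ?_).congr fun x hx => (hd x hx).fderiv
    exact (hF.fderiv_of_isOpen hW (by simp)).clm_comp contDiffOn_const

/-- Integrals of smooth functions over a compact interval depend smoothly on parameters. -/
theorem contDiffOn_intervalIntegral {G : Type u} [NormedAddCommGroup G]
    [NormedSpace ℝ G] {W : Set (E × ℝ)} (hW : IsOpen W) {V : Set E} (hV : IsOpen V) {a b : ℝ}
    (hab : a ≤ b) (hVW : V ×ˢ Icc a b ⊆ W) {F : E × ℝ → G} (hF : ContDiffOn ℝ ∞ F W) :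
    ContDiffOn ℝ ∞ (fun x => ∫ t in a..b, F (x, t)) V :=
  contDiffOn_infty.2 fun n => contDiffOn_nat_intervalIntegral n hW hV hab hVW hF

end ParametricIntegral

namespace SpaceCurve

open Set Filter Topology

/-! ### The cross product -/

theorem cross_add_left (u v w : E3) : cross (u + v) w = cross u w + cross v w := by
  simp [cross]

theorem cross_add_right (u v w : E3) : cross u (v + w) = cross u v + cross u w := by
  simp [cross]

theorem cross_smul_left (r : ℝ) (u v : E3) : cross (r • u) v = r • cross u v := by
  simp [cross]

theorem cross_smul_right (r : ℝ) (u v : E3) : cross u (r • v) = r • cross u v := by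
  simp [cross]

theorem cross_same (u : E3) : cross u u = 0 := by
  simp [cross]

/-- The cross product as a continuous bilinear map. -/
noncomputable def crossCLM : E3 →L[ℝ] E3 →L[ℝ] E3 :=
  LinearMap.toContinuousLinearMap ((LinearMap.toContinuousLinearMap (𝕜 := ℝ) (E := E3)
    (F' := E3)).toLinearMap ∘ₗ LinearMap.mk₂ ℝ cross cross_add_left cross_smul_left cross_add_right
      cross_smul_right)

theorem crossCLM_apply (u v : E3) : crossCLM u v = cross u v := rfl

/-- The triple product `⟨u × v, w⟩ = det (u, v, w)`. -/
noncomputable def triple (u v w : E3) : ℝ := inner ℝ (cross u v) w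

theorem triple_eq (u v w : E3) : triple u v w =
    (u 1 * v 2 - u 2 * v 1) * w 0 + (u 2 * v 0 - u 0 * v 2) * w 1 + (u 0 * v 1 - u 1 * v 0) * w 2 := by
  simp [triple, cross, crossProduct, PiLp.inner_apply, Fin.sum_univ_three]
  ring

theorem triple_rotate (u v w : E3) : triple u v w = triple v w u := by
  simp only [triple_eq]; ring

theorem triple_swap (u v w : E3) : triple u v w = - triple v u w := by
  simp only [triple_eq]; ring

/-- A vector whose cross product with `u ≠ 0` vanishes is a multiple of `u`. -/
theorem eq_smul_of_cross_eq_zero {u v : E3} (hu : u ≠ 0) (h : cross u v = 0) :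
    v = (inner ℝ u v / inner ℝ u u) • u := by
  have hne : (inner ℝ u u : ℝ) ≠ 0 := inner_self_ne_zero.2 hu
  have key : (inner ℝ u u : ℝ) • v = (inner ℝ u v : ℝ) • u := by
    have h0 := congrArg (fun w : E3 => w 0) h
    have h1 := congrArg (fun w : E3 => w 1) h
    have h2 := congrArg (fun w : E3 => w 2) h
    simp [cross, crossProduct] at h0 h1 h2
    ext i
    fin_cases i <;>
    simp only [PiLp.inner_apply, Fin.sum_univ_three, PiLp.smul_apply, smul_eq_mul, Fin.zero_eta,
      Fin.mk_one, Fin.reduceFinMk, RCLike.inner_apply, conj_trivial]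
    · linear_combination u 2 * h1 - u 1 * h2
    · linear_combination u 0 * h2 - u 2 * h0
    · linear_combination u 1 * h0 - u 0 * h1
  rw [div_eq_inv_mul, mul_smul, ← key, smul_smul, inv_mul_cancel₀ hne, one_smul]

/-! ### Loops and smooth families of loops -/

theorem Loop.contDiff (c : Loop) : ContDiff ℝ ∞ c.1 := c.2.1

theorem Loop.periodic (c : Loop) : Function.Periodic c.1 (2 * Real.pi) := c.2.2

theorem Loop.ext' {b c : Loop} (h : ∀ θ, b.1 θ = c.1 θ) : b = c := Subtype.ext (funext h)

theorem Loop.add_apply (b c : Loop) (θ : ℝ) : (b + c).1 θ = b.1 θ + c.1 θ := rfl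

theorem Loop.sub_apply (b c : Loop) (θ : ℝ) : (b - c).1 θ = b.1 θ - c.1 θ := rfl

theorem Loop.smul_apply (r : ℝ) (c : Loop) (θ : ℝ) : (r • c).1 θ = r • c.1 θ := rfl

theorem Loop.differentiableAt (c : Loop) (θ : ℝ) : DifferentiableAt ℝ c.1 θ :=
  c.contDiff.differentiable (by simp) θ

theorem Loop.continuous (c : Loop) : Continuous c.1 := c.contDiff.continuous

theorem periodic_deriv {F : Type*} [NormedAddCommGroup F] [NormedSpace ℝ F] {f : ℝ → F} {p : ℝ}
    (hf : Function.Periodic f p) : Function.Periodic (deriv f) p := fun θ => by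
  rw [← deriv_comp_add_const, show (fun x => f (x + p)) = f from funext hf]

/-- The angular derivative of a loop. -/
noncomputable def derivLoop : Loop →ₗ[ℝ] Loop where
  toFun c := ⟨deriv c.1, (contDiff_infty_iff_deriv.1 c.contDiff).2, periodic_deriv c.periodic⟩
  map_add' b c := Loop.ext' fun θ => by
    show deriv (b.1 + c.1) θ = deriv b.1 θ + deriv c.1 θ
    exact deriv_add (b.differentiableAt θ) (c.differentiableAt θ)
  map_smul' r c := Loop.ext' fun θ => by
    show deriv (r • c.1) θ = r • deriv c.1 θ
    exact deriv_const_smul r (c.differentiableAt θ)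

theorem derivLoop_apply (c : Loop) (θ : ℝ) : (derivLoop c).1 θ = deriv c.1 θ := rfl

theorem toLoop_apply {f : ℝ → E3} (hf : f ∈ loopSubmodule) (θ : ℝ) : (toLoop f).1 θ = f θ := by
  simp [toLoop, hf]

theorem toLoop_coe (c : Loop) : toLoop c.1 = c := Loop.ext' fun θ => toLoop_apply c.2 θ

section Plots

variable {P Q : Type*} [NormedAddCommGroup P] [NormedSpace ℝ P] [NormedAddCommGroup Q]
  [NormedSpace ℝ Q] {U : Set P} {γ δ : P → Loop}

theorem IsPlot.isOpen_prod (hγ : IsPlot U γ) : IsOpen (U ×ˢ (univ : Set ℝ)) :=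
  hγ.1.prod isOpen_univ

theorem IsPlot.mono (hγ : IsPlot U γ) {V : Set P} (hV : IsOpen V) (h : V ⊆ U) : IsPlot V γ :=
  ⟨hV, hγ.2.mono (prod_mono h le_rfl)⟩

theorem IsPlot.congr (hγ : IsPlot U γ) (h : ∀ x ∈ U, δ x = γ x) : IsPlot U δ :=
  ⟨hγ.1, hγ.2.congr fun z hz => by rw [h _ hz.1]⟩

theorem IsPlot.comp (hγ : IsPlot U γ) {V : Set Q} (hV : IsOpen V) {g : Q → P}
    (hg : ContDiffOn ℝ ∞ g V) (h : MapsTo g V U) : IsPlot V (fun y => γ (g y)) := by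
  refine ⟨hV, hγ.2.comp (f := fun z : Q × ℝ => (g z.1, z.2)) ?_ fun z hz => ⟨h hz.1, trivial⟩⟩
  exact (hg.comp contDiffOn_fst fun z hz => hz.1).prodMk contDiffOn_snd

theorem IsPlot.add (hγ : IsPlot U γ) (hδ : IsPlot U δ) : IsPlot U (fun x => γ x + δ x) :=
  ⟨hγ.1, hγ.2.add hδ.2⟩

theorem IsPlot.smul (hγ : IsPlot U γ) {f : P → ℝ} (hf : ContDiffOn ℝ ∞ f U) :
    IsPlot U (fun x => f x • γ x) :=
  ⟨hγ.1, (hf.comp contDiffOn_fst fun _ hz => hz.1).smul hγ.2⟩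

theorem isPlot_const (hU : IsOpen U) (c : Loop) : IsPlot U (fun _ => c) :=
  ⟨hU, (c.contDiff.comp contDiff_snd).contDiffOn⟩

theorem IsPlot.fst (hγ : IsPlot U γ) {V : Set Q} (hV : IsOpen V) :
    IsPlot (U ×ˢ V) (fun z => γ z.1) :=
  hγ.comp (hγ.1.prod hV) contDiffOn_fst fun _ hz => hz.1

theorem IsPlot.snd (hγ : IsPlot U γ) {V : Set Q} (hV : IsOpen V) :
    IsPlot (V ×ˢ U) (fun z => γ z.2) :=
  hγ.comp (hV.prod hγ.1) contDiffOn_snd fun _ hz => hz.2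

/-- The family of lines with base points `γ x` and directions `δ x`. -/
theorem IsPlot.line (hγ : IsPlot U γ) (hδ : IsPlot U δ) :
    IsPlot (U ×ˢ (univ : Set ℝ)) (fun z => γ z.1 + z.2 • δ z.1) :=
  (hγ.fst isOpen_univ).add ((hδ.fst isOpen_univ).smul contDiffOn_snd)

theorem isPlot_line (c h : Loop) : IsPlot univ (fun t : ℝ => c + t • h) :=
  (isPlot_const isOpen_univ c).add ((isPlot_const isOpen_univ h).smul contDiffOn_id)

theorem isPlot_plane (c h k : Loop) :
    IsPlot univ (fun v : ℝ × ℝ => c + (v.1 • h + v.2 • k)) :=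
  (isPlot_const isOpen_univ c).add
    (((isPlot_const isOpen_univ h).smul contDiffOn_fst).add
      ((isPlot_const isOpen_univ k).smul contDiffOn_snd))

theorem IsPlot.hasFDerivAt (hγ : IsPlot U γ) {x : P} (hx : x ∈ U) (θ : ℝ) :
    HasFDerivAt (fun p : P × ℝ => (γ p.1).1 p.2)
      (fderiv ℝ (fun p : P × ℝ => (γ p.1).1 p.2) (x, θ)) (x, θ) :=
  ((hγ.2.differentiableOn (by simp)).differentiableAt
    (hγ.isOpen_prod.mem_nhds ⟨hx, trivial⟩)).hasFDerivAt

theorem IsPlot.contDiffOn_fderiv (hγ : IsPlot U γ) :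
    ContDiffOn ℝ ∞ (fderiv ℝ (fun p : P × ℝ => (γ p.1).1 p.2)) (U ×ˢ univ) :=
  hγ.2.fderiv_of_isOpen hγ.isOpen_prod (by simp)

theorem IsPlot.deriv (hγ : IsPlot U γ) : IsPlot U (fun x => derivLoop (γ x)) := by
  refine ⟨hγ.1, (hγ.contDiffOn_fderiv.clm_apply
    (contDiffOn_const (c := ((0 : P), (1 : ℝ))))).congr fun z hz => ?_⟩
  have := (hγ.hasFDerivAt hz.1 z.2).comp_hasDerivAt z.2
    ((hasDerivAt_const z.2 z.1).prodMk (hasDerivAt_id z.2))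
  exact this.deriv

/-- `toLoop` has the default value 0; the second conclusion records that the default does not occur
on U. -/
theorem isPlot_toLoop (hU : IsOpen U) {F : P × ℝ → E3} (hF : ContDiffOn ℝ ∞ F (U ×ˢ univ))
    (hper : ∀ x ∈ U, ∀ θ, F (x, θ + 2 * Real.pi) = F (x, θ)) :
    IsPlot U (fun x => toLoop (fun θ => F (x, θ))) ∧
      ∀ x ∈ U, ∀ θ, (toLoop (fun θ => F (x, θ))).1 θ = F (x, θ) := by
  have hmem : ∀ x ∈ U, (fun θ => F (x, θ)) ∈ loopSubmodule := fun x hx =>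
    ⟨contDiffOn_univ.1 (hF.comp (by fun_prop) fun θ _ => ⟨hx, trivial⟩), hper x hx⟩
  exact ⟨⟨hU, hF.congr fun z hz => toLoop_apply (hmem z.1 hz.1) z.2⟩,
    fun x hx θ => toLoop_apply (hmem x hx) θ⟩

/-- Being an immersion is an open condition in smooth families. -/
theorem IsPlot.isOpen_imm (hγ : IsPlot U γ) : IsOpen {x | x ∈ U ∧ γ x ∈ Imm} := by
  rw [isOpen_iff_mem_nhds]
  rintro x ⟨hx, hxI⟩
  -- One compact period suffices, and periodicity extends the condition to all angles.
  have hev : ∀ᶠ y in 𝓝 x, ∀ θ ∈ Icc 0 (2 * Real.pi), (derivLoop (γ y)).1 θ ≠ 0 := by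
    refine isCompact_Icc.eventually_forall_of_forall_eventually fun θ _ => ?_
    exact ((hγ.deriv.2.continuousOn).continuousAt
      (hγ.isOpen_prod.mem_nhds ⟨hx, trivial⟩)).eventually_ne (hxI θ)
  filter_upwards [hev, hγ.1.mem_nhds hx] with y hy hyU
  refine ⟨hyU, fun θ => ?_⟩
  obtain ⟨θ', hθ', he⟩ := (derivLoop (γ y)).periodic.exists_mem_Ico₀ Real.two_pi_pos θ
  rw [← derivLoop_apply, he]
  exact hy θ' (Ico_subset_Icc_self hθ')

theorem IsPlot.restrict_imm (hγ : IsPlot U γ) : IsPlot {x | x ∈ U ∧ γ x ∈ Imm} γ :=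
  hγ.mono hγ.isOpen_imm fun _ hx => hx.1

end Plots

/-- Integrals over the circle depend smoothly on parameters. -/
theorem contDiffOn_circleIntegral {P : Type} [NormedAddCommGroup P] [NormedSpace ℝ P] {U : Set P}
    (hU : IsOpen U) {F : P × ℝ → ℝ} (hF : ContDiffOn ℝ ∞ F (U ×ˢ univ)) :
    ContDiffOn ℝ ∞ (fun x => ∫ θ in (0 : ℝ)..(2 * Real.pi), F (x, θ)) U :=
  contDiffOn_intervalIntegral (hU.prod isOpen_univ) hU Real.two_pi_pos.le
    (prod_mono le_rfl (subset_univ _)) hF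

/-! ### Velocities -/

theorem IsVelocity.unique {γ : ℝ → Loop} {t : ℝ} {h k : Loop} (hh : IsVelocity γ t h)
    (hk : IsVelocity γ t k) : h = k :=
  Loop.ext' fun θ => (hh θ).unique (hk θ)

theorem isVelocity_line (c h : Loop) (t : ℝ) : IsVelocity (fun s : ℝ => c + s • h) t h := fun θ => by
  show HasDerivAt (fun s : ℝ => c.1 θ + s • h.1 θ) (h.1 θ) t
  simpa using ((hasDerivAt_id t).smul_const (h.1 θ)).const_add (c.1 θ)

theorem IsVelocity.smul {γ : ℝ → Loop} {t : ℝ} {h : Loop} (hγ : IsVelocity γ t h) {f : ℝ → ℝ}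
    {f' : ℝ} (hf : HasDerivAt f f' t) :
    IsVelocity (fun s => f s • γ s) t (f t • h + f' • γ t) :=
  fun θ => hf.smul (hγ θ)

/-- Hadamard's lemma for smooth paths of loops. -/
theorem IsPlot.exists_eq_add_smul {U : Set ℝ} {γ : ℝ → Loop} (hγ : IsPlot U γ) {t₀ : ℝ}
    (ht₀ : t₀ ∈ U) : ∃ (V : Set ℝ) (q : ℝ → Loop), t₀ ∈ V ∧ V ⊆ U ∧ IsPlot V q ∧
      (∀ t ∈ V, γ t = γ t₀ + (t - t₀) • q t) ∧ IsVelocity γ t₀ (q t₀) := by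
  obtain ⟨ε, hε, hball⟩ := Metric.isOpen_iff.1 hγ.1 t₀ ht₀
  set V := Metric.ball t₀ ε with hVdef
  set Γ : ℝ × ℝ → E3 := fun p => (γ p.1).1 p.2 with hΓ
  -- The quotient (γ t - γ t₀)/(t - t₀) as the mean of the time derivative over the segment from t₀
  -- to t, which is smooth also at t₀. V is a ball so that these segments stay in U.
  set F : ℝ × ℝ → E3 := fun z => ∫ s in (0 : ℝ)..1, fderiv ℝ Γ (t₀ + s * (z.1 - t₀), z.2) (1, 0)
    with hFdef
  have hseg : ∀ t ∈ V, ∀ s ∈ Icc (0 : ℝ) 1, t₀ + s * (t - t₀) ∈ U := fun t ht s hs => by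
    refine hball ?_
    have := (convex_ball t₀ ε).add_smul_sub_mem (Metric.mem_ball_self hε) ht hs
    simpa only [smul_eq_mul] using this
  have hd : ∀ t ∈ U, ∀ θ, HasDerivAt (fun s => Γ (s, θ)) (fderiv ℝ Γ (t, θ) (1, 0)) t := by
    intro t ht θ
    exact (hγ.hasFDerivAt ht θ).comp_hasDerivAt t
      ((hasDerivAt_id t).prodMk (hasDerivAt_const t θ))
  have hF : ContDiffOn ℝ ∞ F (V ×ˢ univ) := by
    refine contDiffOn_intervalIntegral (E := ℝ × ℝ)
      (W := {z : (ℝ × ℝ) × ℝ | t₀ + z.2 * (z.1.1 - t₀) ∈ U})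
      (hγ.1.preimage (by fun_prop)) (Metric.isOpen_ball.prod isOpen_univ) zero_le_one ?_
      (F := fun z => fderiv ℝ Γ (t₀ + z.2 * (z.1.1 - t₀), z.1.2) (1, 0)) ?_
    · rintro ⟨z, s⟩ ⟨hz, hs⟩
      exact hseg z.1 hz.1 s hs
    · exact (hγ.contDiffOn_fderiv.comp (f := fun z : (ℝ × ℝ) × ℝ =>
        (t₀ + z.2 * (z.1.1 - t₀), z.1.2)) (by fun_prop) fun z hz => ⟨hz, trivial⟩).clm_apply
          contDiffOn_const
  have hderiv : ∀ t ∈ U, ∀ θ, fderiv ℝ Γ (t, θ + 2 * Real.pi) (1, 0) = fderiv ℝ Γ (t, θ) (1, 0) := by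
    intro t ht θ
    refine (hd t ht (θ + 2 * Real.pi)).unique ?_
    have : (fun s => Γ (s, θ + 2 * Real.pi)) = fun s => Γ (s, θ) :=
      funext fun s => (γ s).periodic θ
    rw [this]
    exact hd t ht θ
  obtain ⟨hq, hqF⟩ := isPlot_toLoop (F := F) Metric.isOpen_ball hF fun t ht θ => by
    refine intervalIntegral.integral_congr fun s hs => ?_
    rw [uIcc_of_le zero_le_one] at hs
    exact hderiv _ (hseg t ht s hs) θ
  refine ⟨V, _, Metric.mem_ball_self hε, hball, hq, fun t ht => Loop.ext' fun θ => ?_, fun θ => ?_⟩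
  · rw [Loop.add_apply, Loop.smul_apply, hqF t ht θ]
    have := intervalIntegral.integral_unitInterval_deriv_eq_sub (z₀ := t₀) (z₁ := t - t₀)
      (f := fun s => Γ (s, θ)) (f' := fun s => fderiv ℝ Γ (s, θ) (1, 0)) ?_ fun s hs => hd _ ?_ θ
    · simp only [smul_eq_mul] at this
      rw [hFdef]
      simp only
      rw [this]
      simp [hΓ]
    · refine ((hγ.contDiffOn_fderiv.continuousOn).comp (by fun_prop) fun s hs =>
        ⟨hseg t ht s hs, trivial⟩).clm_apply continuousOn_const
    · exact hseg t ht s hs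
  · rw [hqF t₀ (Metric.mem_ball_self hε) θ]
    simpa [hFdef] using hd t₀ ht₀ θ

/-! ### Calculus of smooth functions on the space of immersions -/

section Transfer

variable {P : Type*} [NormedAddCommGroup P] [NormedSpace ℝ P] [FiniteDimensional ℝ P] {U : Set P}
  {γ : P → Loop}

/-- Smoothness is defined by families over `EuclideanSpace ℝ (Fin n)`; a linear isomorphism extends
it to any finite-dimensional parameter space, such as ℝ × ℝ. -/
theorem IsPlot.toEuclidean_symm (hγ : IsPlot U γ) :
    IsPlot ((toEuclidean (E := P)).symm ⁻¹' U) (fun y => γ ((toEuclidean (E := P)).symm y)) :=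
  hγ.comp (hγ.1.preimage (toEuclidean (E := P)).symm.continuous)
    (toEuclidean (E := P)).symm.contDiff.contDiffOn fun _ hy => hy

theorem ContDiffOn.of_toEuclidean_symm {F : Type*} [NormedAddCommGroup F] [NormedSpace ℝ F]
    {f : P → F} (hf : ContDiffOn ℝ ∞ (fun y => f ((toEuclidean (E := P)).symm y))
      ((toEuclidean (E := P)).symm ⁻¹' U)) : ContDiffOn ℝ ∞ f U := by
  refine (hf.comp (toEuclidean (E := P)).contDiff.contDiffOn fun x hx => ?_).congr fun x hx => ?_
  · simpa using hx
  · simp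

theorem IsSmoothFun.contDiffOn {f : Loop → ℝ} (hf : IsSmoothFun f) (hγ : IsPlot U γ)
    (hI : ∀ x ∈ U, γ x ∈ Imm) : ContDiffOn ℝ ∞ (fun x => f (γ x)) U :=
  ContDiffOn.of_toEuclidean_symm (hf _ _ _ ⟨hγ.toEuclidean_symm, fun _ hy => hI _ hy⟩)

theorem IsSmoothField.isPlot {Y : Loop → Loop} (hY : IsSmoothField Y) (hγ : IsPlot U γ)
    (hI : ∀ x ∈ U, γ x ∈ Imm) : IsPlot U (fun x => Y (γ x)) := by
  refine ((hY _ _ _ ⟨hγ.toEuclidean_symm, fun _ hy => hI _ hy⟩).comp hγ.1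
    (toEuclidean (E := P)).contDiff.contDiffOn fun x hx => ?_).congr fun x hx => ?_
  · simpa using hx
  · simp

theorem IsSmoothTwoForm.contDiffOn {Ω : Loop → Loop → Loop → ℝ} (hΩ : IsSmoothTwoForm Ω)
    (hγ : IsPlot U γ) (hI : ∀ x ∈ U, γ x ∈ Imm) {h k : P → Loop} (hh : IsPlot U h)
    (hk : IsPlot U k) : ContDiffOn ℝ ∞ (fun x => Ω (γ x) (h x) (k x)) U :=
  ContDiffOn.of_toEuclidean_symm (hΩ.2 _ _ _ _ _ ⟨hγ.toEuclidean_symm, fun _ hy => hI _ hy⟩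
    hh.toEuclidean_symm hk.toEuclidean_symm)

end Transfer

theorem isOpen_line {c h : Loop} : IsOpen {t : ℝ | c + t • h ∈ Imm} := by
  simpa using (isPlot_line c h).isOpen_imm

theorem zero_mem_line {c : Loop} (hc : c ∈ Imm) (h : Loop) : (0 : ℝ) ∈ {t : ℝ | c + t • h ∈ Imm} := by
  simpa using hc

theorem eventually_line {c : Loop} (hc : c ∈ Imm) (h : Loop) :
    ∀ᶠ t : ℝ in 𝓝 0, c + t • h ∈ Imm :=
  isOpen_line.mem_nhds (zero_mem_line hc h)

theorem isPlot_line_imm (c h : Loop) :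
    IsPlot {t : ℝ | c + t • h ∈ Imm} (fun t : ℝ => c + t • h) :=
  (isPlot_line c h).mono isOpen_line (subset_univ _)

theorem IsSmoothFun.hasDerivAt_line {f : Loop → ℝ} (hf : IsSmoothFun f) {c : Loop} (hc : c ∈ Imm)
    (h : Loop) : HasDerivAt (fun t : ℝ => f (c + t • h)) (dirDeriv f c h) 0 :=
  (((hf.contDiffOn (isPlot_line_imm c h) fun _ ht => ht).differentiableOn (by simp)).differentiableAt
    (eventually_line hc h)).hasDerivAt

/-- Directional derivatives in the plane through `c` spanned by `h` and `k`. -/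
theorem IsSmoothFun.dirDeriv_plane {f : Loop → ℝ} (hf : IsSmoothFun f) (c h k : Loop)
    {v : ℝ × ℝ} (hv : c + (v.1 • h + v.2 • k) ∈ Imm) (w : ℝ × ℝ) :
    dirDeriv f (c + (v.1 • h + v.2 • k)) (w.1 • h + w.2 • k) =
      fderiv ℝ (fun v : ℝ × ℝ => f (c + (v.1 • h + v.2 • k))) v w := by
  have hpl := (isPlot_plane c h k).restrict_imm
  have hd := (((hf.contDiffOn hpl fun _ ht => ht.2).differentiableOn (by simp)).differentiableAt
    (hpl.1.mem_nhds ⟨trivial, hv⟩)).hasFDerivAt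
  have hl : HasDerivAt (fun t : ℝ => v + t • w) w 0 := by
    simpa using ((hasDerivAt_id (0 : ℝ)).smul_const w).const_add v
  have hz : v + (0 : ℝ) • w = v := by simp
  rw [← hz] at hd
  have := (hd.comp_hasDerivAt (0 : ℝ) hl).deriv
  rw [hz] at this
  rw [← this, dirDeriv]
  congr 1
  funext t
  simp only [Function.comp, Prod.fst_add, Prod.smul_fst, Prod.snd_add, Prod.smul_snd, smul_eq_mul]
  congr 1
  module

/-- On the plane through c in the directions h, k the function is smooth in two real variables, so
its directional derivatives are values of one linear Fréchet derivative. -/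
theorem IsSmoothFun.dirDeriv_linear {f : Loop → ℝ} (hf : IsSmoothFun f) {c : Loop} (hc : c ∈ Imm) :
    IsLinearMap ℝ (dirDeriv f c) where
  map_add h k := by
    have := fun w => hf.dirDeriv_plane c h k (v := 0) (by simpa using hc) w
    simp only [Prod.fst_zero, Prod.snd_zero, zero_smul, add_zero] at this
    have h1 := this (1, 0)
    have h2 := this (0, 1)
    have h3 := this (1, 1)
    simp only [one_smul, zero_smul, add_zero, zero_add] at h1 h2 h3
    rw [h1, h2, h3, ← map_add]
    simp
  map_smul r h := by
    have := fun w => hf.dirDeriv_plane c h h (v := 0) (by simpa using hc) w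
    simp only [Prod.fst_zero, Prod.snd_zero, zero_smul, add_zero] at this
    have h1 := this (1, 0)
    have h2 := this (r, 0)
    simp only [one_smul, zero_smul, add_zero] at h1 h2
    rw [h1, h2, ← map_smul]
    simp

/-- Second directional derivatives are symmetric. -/
theorem IsSmoothFun.dirDeriv_comm {f : Loop → ℝ} (hf : IsSmoothFun f) {c : Loop} (hc : c ∈ Imm)
    (h k : Loop) :
    dirDeriv (fun b => dirDeriv f b k) c h = dirDeriv (fun b => dirDeriv f b h) c k := by
  have hpl := (isPlot_plane c h k).restrict_imm
  set F : ℝ × ℝ → ℝ := fun v => f (c + (v.1 • h + v.2 • k)) with hF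
  have h0 : (0 : ℝ × ℝ) ∈ {x : ℝ × ℝ | x ∈ univ ∧ c + (x.1 • h + x.2 • k) ∈ Imm} :=
    ⟨trivial, by simpa using hc⟩
  have hFs := hf.contDiffOn hpl fun _ ht => ht.2
  have hF0 : ContDiffAt ℝ ∞ F 0 := hFs.contDiffAt (hpl.1.mem_nhds h0)
  have hd : DifferentiableAt ℝ (fderiv ℝ F) 0 :=
    ((hFs.fderiv_of_isOpen hpl.1 (m := ∞) (by simp)).contDiffAt
      (hpl.1.mem_nhds h0)).differentiableAt (by simp)
  have hsymm := hF0.isSymmSndFDerivAt (by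
    rw [minSmoothness_of_isRCLikeNormedField]
    exact WithTop.coe_le_coe.2 (le_top (a := (2 : ℕ∞))))
  -- Iterated directional derivatives in the plane are the second Fréchet derivative of F, which is
  -- symmetric.
  have key : ∀ v w : ℝ × ℝ,
      dirDeriv (fun b => dirDeriv f b (w.1 • h + w.2 • k)) c (v.1 • h + v.2 • k) =
        fderiv ℝ (fderiv ℝ F) 0 v w := by
    intro v w
    have hl : HasDerivAt (fun t : ℝ => t • v) v 0 := by
      simpa using (hasDerivAt_id (0 : ℝ)).smul_const v
    have h1 := (hd.hasFDerivAt.comp_hasDerivAt_of_eq (0 : ℝ) hl (zero_smul ℝ v).symm).clm_apply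
      (hasDerivAt_const (0 : ℝ) w)
    have hev : (fun t : ℝ => dirDeriv f (c + t • (v.1 • h + v.2 • k)) (w.1 • h + w.2 • k)) =ᶠ[𝓝 0]
        fun t => (fderiv ℝ F ∘ fun t : ℝ => t • v) t w := by
      filter_upwards [eventually_line hc (v.1 • h + v.2 • k)] with t ht
      have hv : c + t • (v.1 • h + v.2 • k) = c + ((t • v).1 • h + (t • v).2 • k) := by
        simp only [Prod.smul_fst, Prod.smul_snd, smul_eq_mul]
        module
      rw [hv] at ht ⊢
      exact hf.dirDeriv_plane c h k ht w
    have := (h1.congr_of_eventuallyEq hev).deriv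
    rw [dirDeriv, this]
    simp
  have h1 := key (1, 0) (0, 1)
  have h2 := key (0, 1) (1, 0)
  simp only [one_smul, zero_smul, add_zero, zero_add] at h1 h2
  rw [h1, h2]
  exact hsymm.eq _ _

/-- The derivative of a smooth function along a smooth family of tangent vectors is smooth. -/
theorem IsSmoothFun.contDiffOn_dirDeriv {f : Loop → ℝ} (hf : IsSmoothFun f) {P : Type*}
    [NormedAddCommGroup P] [NormedSpace ℝ P] [FiniteDimensional ℝ P] {U : Set P} {γ h : P → Loop}
    (hγ : IsPlot U γ) (hI : ∀ x ∈ U, γ x ∈ Imm) (hh : IsPlot U h) :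
    ContDiffOn ℝ ∞ (fun x => dirDeriv f (γ x) (h x)) U := by
  -- The lines γ x + t • h x form a smooth family in (x, t), and the derivative sought is the
  -- t-derivative at t = 0.
  have hpl := (hγ.line hh).restrict_imm
  have hF := hf.contDiffOn hpl fun _ ht => ht.2
  have hmem : ∀ x ∈ U, (x, (0 : ℝ)) ∈ {z : P × ℝ | z ∈ U ×ˢ univ ∧ γ z.1 + z.2 • h z.1 ∈ Imm} :=
    fun x hx => ⟨⟨hx, trivial⟩, by simpa using hI x hx⟩
  have h1 := ((hF.fderiv_of_isOpen hpl.1 (m := ∞) (by simp)).comp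
    (f := fun x : P => (x, (0 : ℝ))) (by fun_prop) hmem).clm_apply
      (contDiffOn_const (c := ((0 : P), (1 : ℝ))))
  refine h1.congr fun x hx => ?_
  have hd := ((hF.differentiableOn (by simp)).differentiableAt (hpl.1.mem_nhds (hmem x hx))).hasFDerivAt
  exact (hd.comp_hasDerivAt (0 : ℝ) ((hasDerivAt_const (0 : ℝ) x).prodMk (hasDerivAt_id 0))).deriv

theorem IsSmoothFun.dirDeriv {f : Loop → ℝ} (hf : IsSmoothFun f) (h : Loop) :
    IsSmoothFun (fun c => dirDeriv f c h) := fun _ _ _ hγ =>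
  hf.contDiffOn_dirDeriv hγ.1 hγ.2 (isPlot_const hγ.1.1 h)

/-- The chain rule for smooth functions along smooth paths. -/
theorem IsSmoothFun.hasDerivAt_comp {f : Loop → ℝ} (hf : IsSmoothFun f) {U : Set ℝ} {γ : ℝ → Loop}
    (hγ : IsPlot U γ) (hI : ∀ t ∈ U, γ t ∈ Imm) {t : ℝ} (ht : t ∈ U) {h : Loop}
    (hv : IsVelocity γ t h) : HasDerivAt (fun s => f (γ s)) (SpaceCurve.dirDeriv f (γ t) h) t := by
  obtain ⟨V, q, htV, hVU, hq, hqe, hqv⟩ := hγ.exists_eq_add_smul ht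
  obtain rfl := hqv.unique hv
  -- By Hadamard's lemma f ∘ γ is (r, s) ↦ f (γ t + r • q s) restricted to r = s - t. At r = 0 the
  -- s-derivative vanishes, and at (0, t) the r-derivative is the directional derivative along q t.
  have hpl : IsPlot (univ ×ˢ V : Set (ℝ × ℝ)) (fun v => γ t + v.1 • q v.2) :=
    (isPlot_const (isOpen_univ.prod hq.1) (γ t)).add ((hq.snd isOpen_univ).smul contDiffOn_fst)
  have hpl' := hpl.restrict_imm
  have hmem : ((0 : ℝ), t) ∈ {v : ℝ × ℝ | v ∈ (univ ×ˢ V : Set (ℝ × ℝ)) ∧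
      γ t + v.1 • q v.2 ∈ Imm} := ⟨⟨trivial, htV⟩, by simpa using hI t ht⟩
  have hd := (((hf.contDiffOn hpl' fun _ ht => ht.2).differentiableOn (by simp)).differentiableAt
    (hpl'.1.mem_nhds hmem)).hasFDerivAt
  set L := fderiv ℝ (fun v : ℝ × ℝ => f (γ t + v.1 • q v.2)) (0, t) with hL
  have h1 : L (1, 0) = SpaceCurve.dirDeriv f (γ t) (q t) :=
    ((hd.comp_hasDerivAt (0 : ℝ)
      ((hasDerivAt_id (0 : ℝ)).prodMk (hasDerivAt_const (0 : ℝ) t))).deriv).symm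
  have h2 : L (0, 1) = 0 := by
    have := hd.comp_hasDerivAt t ((hasDerivAt_const t (0 : ℝ)).prodMk (hasDerivAt_id t))
    refine this.unique ?_
    simpa [Function.comp_def] using hasDerivAt_const t (f (γ t))
  have h3 : HasDerivAt (fun s : ℝ => (s - t, s)) (1, 1) t :=
    ((hasDerivAt_id t).sub_const t).prodMk (hasDerivAt_id t)
  have h4 := hd.comp_hasDerivAt_of_eq t h3 (by simp)
  have h5 : L (1, 1) = SpaceCurve.dirDeriv f (γ t) (q t) := by
    have h6 : L (1, 1) = L (1, 0) + L (0, 1) := by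
      rw [← map_add]
      simp
    rw [h6, h1, h2, add_zero]
  rw [h5] at h4
  refine h4.congr_of_eventuallyEq ?_
  filter_upwards [hq.1.mem_nhds htV] with s hs
  simp only [Function.comp]
  rw [← hqe s hs]

/-! ### Derivatives of vector fields and two-forms -/

/-- `fieldDeriv` is assembled pointwise in θ through `toLoop`; Hadamard's lemma shows that the
pointwise derivatives do form a loop. -/
theorem IsSmoothField.isVelocity_line {Y : Loop → Loop} (hY : IsSmoothField Y) {c : Loop}
    (hc : c ∈ Imm) (h : Loop) :
    IsVelocity (fun t : ℝ => Y (c + t • h)) 0 (fieldDeriv Y c h) := by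
  obtain ⟨V, q, -, -, -, -, hv⟩ := (hY.isPlot (isPlot_line_imm c h) fun _ ht => ht).exists_eq_add_smul
    (zero_mem_line hc h)
  have : fieldDeriv Y c h = q 0 := by
    rw [fieldDeriv, ← toLoop_coe (q 0)]
    congr 1
    funext θ
    exact (hv θ).deriv
  rw [this]
  exact hv

theorem IsSmoothTwoForm.isSmoothFun {Ω : Loop → Loop → Loop → ℝ} (hΩ : IsSmoothTwoForm Ω)
    (h k : Loop) : IsSmoothFun (fun c => Ω c h k) := fun _ _ _ hγ =>
  hΩ.contDiffOn hγ.1 hγ.2 (isPlot_const hγ.1.1 h) (isPlot_const hγ.1.1 k)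

theorem IsSmoothTwoForm.swap {Ω : Loop → Loop → Loop → ℝ} (hΩ : IsSmoothTwoForm Ω) {c : Loop}
    (hc : c ∈ Imm) (h k : Loop) : Ω c h k = - Ω c k h := by
  have h1 := (hΩ.1 c hc).2.2 (h + k)
  rw [((hΩ.1 c hc).1 _).map_add, ((hΩ.1 c hc).2.1 _).map_add, ((hΩ.1 c hc).2.1 _).map_add,
    (hΩ.1 c hc).2.2, (hΩ.1 c hc).2.2] at h1
  linarith

/-- The Leibniz rule for the contraction of a two-form with a vector field. -/
theorem IsSmoothTwoForm.hasDerivAt_contract {Ω : Loop → Loop → Loop → ℝ} (hΩ : IsSmoothTwoForm Ω)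
    {Y : Loop → Loop} (hY : IsSmoothField Y) {c : Loop} (hc : c ∈ Imm) (h k : Loop) :
    HasDerivAt (fun t : ℝ => Ω (c + t • h) (Y (c + t • h)) k)
      (dirDeriv (fun b => Ω b (Y c) k) c h + Ω c (fieldDeriv Y c h) k) 0 := by
  set T := {t : ℝ | c + t • h ∈ Imm} with hT
  have hYp : IsPlot T (fun t : ℝ => Y (c + t • h)) := hY.isPlot (isPlot_line_imm c h) fun _ ht => ht
  have hT0 : (0 : ℝ) ∈ T := zero_mem_line hc h
  -- With Y (c + t • h) = Y c + t • q t, linearity splits the contraction into a term with the fixed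
  -- vector Y c and t times a differentiable function whose value at 0 is the second summand.
  obtain ⟨V, q, h0V, -, hq, hqe, hqv⟩ := hYp.exists_eq_add_smul hT0
  have hq0 : q 0 = fieldDeriv Y c h := hqv.unique (hY.isVelocity_line hc h)
  have hopen : IsOpen (T ×ˢ V) := (isPlot_line_imm c h).1.prod hq.1
  have hs := hΩ.contDiffOn (U := T ×ˢ V) (γ := fun v => c + v.1 • h)
    (h := fun v => q v.2) (k := fun _ => k)
    ((isPlot_line_imm c h).fst hq.1) (fun v hv => hv.1) (hq.snd (isPlot_line_imm c h).1)
    (isPlot_const hopen k)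
  have hdiag : ContDiffOn ℝ ∞ (fun t : ℝ => Ω (c + t • h) (q t) k) (T ∩ V) :=
    hs.comp (f := fun t : ℝ => (t, t)) (by fun_prop) fun t ht => ht
  have hnhds : T ∩ V ∈ 𝓝 (0 : ℝ) :=
    inter_mem ((isPlot_line_imm c h).1.mem_nhds hT0) (hq.1.mem_nhds h0V)
  have hd := ((hdiag.differentiableOn (by simp)).differentiableAt hnhds).hasDerivAt
  have h1 := ((hΩ.isSmoothFun (Y c) k).hasDerivAt_line hc h).add ((hasDerivAt_id (0 : ℝ)).mul hd)
  simp only [id, zero_smul, add_zero, one_mul, zero_mul, hq0] at h1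
  refine h1.congr_of_eventuallyEq ?_
  filter_upwards [hnhds] with t ht
  have := hqe t ht.2
  simp only [zero_smul, add_zero, sub_zero] at this
  rw [this, ((hΩ.1 _ ht.1).1 k).map_add, ((hΩ.1 _ ht.1).1 k).map_smul]
  rfl

/-- The Lie derivative of a closed two-form along a field in its kernel vanishes. -/
theorem IsSmoothTwoForm.lieDeriv_eq_zero {Ω : Loop → Loop → Loop → ℝ} (hΩ : IsSmoothTwoForm Ω)
    (hcl : IsClosedTwoForm Ω) {Y : Loop → Loop} (hY : IsSmoothField Y)
    (hker : ∀ c ∈ Imm, ∀ k, Ω c (Y c) k = 0) {c : Loop} (hc : c ∈ Imm) (h k : Loop) :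
    lieDeriv Y Ω c h k = 0 := by
  -- Differentiating i_Y Ω = 0. Antisymmetrizing this and adding dΩ(Y, h, k) = 0 is Cartan's
  -- formula.
  have key : ∀ h k, dirDeriv (fun b => Ω b (Y c) k) c h + Ω c (fieldDeriv Y c h) k = 0 := by
    intro h k
    refine (hΩ.hasDerivAt_contract hY hc h k).unique ?_
    refine (hasDerivAt_const (0 : ℝ) (0 : ℝ)).congr_of_eventuallyEq ?_
    filter_upwards [eventually_line hc h] with t ht
    exact hker _ ht k
  have h1 := key h k
  have h2 := key k h
  have h3 := hcl c hc (Y c) h k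
  have h4 := hΩ.swap hc h (fieldDeriv Y c k)
  rw [dTwo] at h3
  rw [lieDeriv]
  linarith

/-- The exterior derivative of an exact form vanishes. -/
theorem isClosedTwoForm_neg_dOne {α : Loop → Loop → ℝ} (hα : ∀ k, IsSmoothFun (fun c => α c k)) :
    IsClosedTwoForm (fun c h k => - dOne α c h k) := by
  intro c hc h k l
  have key : ∀ h k l, dirDeriv (fun b => - dOne α b k l) c h =
      dirDeriv (fun b => dirDeriv (fun a => α a k) b l) c h -
        dirDeriv (fun b => dirDeriv (fun a => α a l) b k) c h := by
    intro h k l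
    have := ((((hα l).dirDeriv k).hasDerivAt_line hc h).sub
      (((hα k).dirDeriv l).hasDerivAt_line hc h)).neg.deriv
    rw [dirDeriv]
    refine Eq.trans ?_ (this.trans (neg_sub _ _))
    rfl
  rw [dTwo, key, key, key, (hα k).dirDeriv_comm hc h l, (hα h).dirDeriv_comm hc k l,
    (hα l).dirDeriv_comm hc h k]
  ring

/-! ### Integrals over the circle -/

theorem eq_zero_of_circleIntegral_eq_zero {f : ℝ → ℝ} (hf : Continuous f)
    (hper : Function.Periodic f (2 * Real.pi)) (hnn : ∀ θ, 0 ≤ f θ)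
    (hint : ∫ θ in (0 : ℝ)..(2 * Real.pi), f θ = 0) (θ : ℝ) : f θ = 0 := by
  by_contra hne
  obtain ⟨θ', hθ', he⟩ := hper.exists_mem_Ico₀ Real.two_pi_pos θ
  have := intervalIntegral.integral_pos Real.two_pi_pos hf.continuousOn (fun x _ => hnn x)
    ⟨θ', Ico_subset_Icc_self hθ', he ▸ lt_of_le_of_ne (hnn θ) (Ne.symm hne)⟩
  exact this.ne' hint

theorem DiffPlus.differentiableAt (φ : DiffPlus) (θ : ℝ) : DifferentiableAt ℝ φ.lift θ :=
  φ.smooth.differentiable (by simp) θ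

/-- The substitution moves the interval to [φ(0), φ(0) + 2π], another full period. -/
theorem circleIntegral_reparam (φ : DiffPlus) {g : ℝ → ℝ} (hg : Continuous g)
    (hper : Function.Periodic g (2 * Real.pi)) :
    ∫ θ in (0 : ℝ)..(2 * Real.pi), g (φ.lift θ) * deriv φ.lift θ =
      ∫ θ in (0 : ℝ)..(2 * Real.pi), g θ := by
  have h1 := intervalIntegral.integral_comp_mul_deriv (a := 0) (b := 2 * Real.pi) (f := φ.lift)
    (f' := deriv φ.lift) (g := g) (fun θ _ => (φ.differentiableAt θ).hasDerivAt)
    (φ.smooth.continuous_deriv (by simp)).continuousOn hg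
  have h2 := φ.degree_one 0
  rw [zero_add] at h2
  rw [h2, hper.intervalIntegral_add_eq (φ.lift 0) 0, zero_add] at h1
  exact h1

theorem reparam_apply (φ : DiffPlus) (c : Loop) (θ : ℝ) : (reparam φ c).1 θ = c.1 (φ.lift θ) := rfl

theorem deriv_reparam (φ : DiffPlus) (c : Loop) (θ : ℝ) :
    deriv (reparam φ c).1 θ = deriv φ.lift θ • deriv c.1 (φ.lift θ) :=
  ((c.differentiableAt (φ.lift θ)).hasDerivAt.scomp θ (φ.differentiableAt θ).hasDerivAt).deriv

theorem reparam_mem_imm {c : Loop} (hc : c ∈ Imm) (φ : DiffPlus) : reparam φ c ∈ Imm := fun θ => by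
  rw [deriv_reparam]
  exact smul_ne_zero (φ.deriv_pos θ).ne' (hc _)

theorem reparam_add (φ : DiffPlus) (b c : Loop) :
    reparam φ (b + c) = reparam φ b + reparam φ c := rfl

theorem reparam_smul (φ : DiffPlus) (r : ℝ) (c : Loop) :
    reparam φ (r • c) = r • reparam φ c := rfl

theorem smul_mem_imm {c : Loop} (hc : c ∈ Imm) {r : ℝ} (hr : r ≠ 0) : r • c ∈ Imm := fun θ => by
  rw [← derivLoop_apply, map_smul, Loop.smul_apply]
  exact smul_ne_zero hr (hc θ)

/-- The integral of the triple product of three loops. -/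
noncomputable def tripleInt (u v w : Loop) : ℝ :=
  ∫ θ in (0 : ℝ)..(2 * Real.pi), triple (u.1 θ) (v.1 θ) (w.1 θ)

theorem contDiffOn_triple {E : Type*} [NormedAddCommGroup E] [NormedSpace ℝ E] {s : Set E}
    {u v w : E → E3} (hu : ContDiffOn ℝ ∞ u s) (hv : ContDiffOn ℝ ∞ v s)
    (hw : ContDiffOn ℝ ∞ w s) : ContDiffOn ℝ ∞ (fun x => triple (u x) (v x) (w x)) s :=
  (((contDiffOn_const (c := crossCLM)).clm_apply hu).clm_apply hv).inner ℝ hw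

theorem contDiff_triple (u v w : Loop) :
    ContDiff ℝ ∞ (fun θ => triple (u.1 θ) (v.1 θ) (w.1 θ)) :=
  contDiffOn_univ.1 (contDiffOn_triple u.contDiff.contDiffOn v.contDiff.contDiffOn
    w.contDiff.contDiffOn)

theorem triple_periodic (u v w : Loop) :
    Function.Periodic (fun θ => triple (u.1 θ) (v.1 θ) (w.1 θ)) (2 * Real.pi) := fun θ => by
  simp only [u.periodic θ, v.periodic θ, w.periodic θ]

theorem intervalIntegrable_triple (u v w : Loop) :
    IntervalIntegrable (fun θ => triple (u.1 θ) (v.1 θ) (w.1 θ)) MeasureTheory.volume 0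
      (2 * Real.pi) :=
  (contDiff_triple u v w).continuous.intervalIntegrable _ _

theorem tripleInt_rotate (u v w : Loop) : tripleInt u v w = tripleInt v w u :=
  intervalIntegral.integral_congr fun _ _ => triple_rotate _ _ _

theorem tripleInt_swap (u v w : Loop) : tripleInt u v w = - tripleInt v u w := by
  rw [tripleInt, tripleInt, ← intervalIntegral.integral_neg]
  exact intervalIntegral.integral_congr fun _ _ => triple_swap _ _ _

theorem tripleInt_self (u v : Loop) : tripleInt u u v = 0 := by
  have := tripleInt_swap u u v
  linarith

theorem tripleInt_self_right (u v : Loop) : tripleInt u v v = 0 := by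
  rw [tripleInt_rotate, tripleInt_self]

theorem tripleInt_add_right (u v w x : Loop) :
    tripleInt u v (w + x) = tripleInt u v w + tripleInt u v x := by
  rw [tripleInt, tripleInt, tripleInt, ← intervalIntegral.integral_add
    (intervalIntegrable_triple u v w) (intervalIntegrable_triple u v x)]
  exact intervalIntegral.integral_congr fun _ _ => inner_add_right _ _ _

theorem tripleInt_smul_right (u v : Loop) (r : ℝ) (w : Loop) :
    tripleInt u v (r • w) = r * tripleInt u v w := by
  rw [tripleInt, tripleInt, ← intervalIntegral.integral_const_mul]
  exact intervalIntegral.integral_congr fun _ _ => real_inner_smul_right _ _ _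

theorem tripleInt_add_mid (u v w x : Loop) :
    tripleInt u (v + w) x = tripleInt u v x + tripleInt u w x := by
  rw [← tripleInt_rotate x u, tripleInt_add_right, tripleInt_rotate x u, tripleInt_rotate x u]

theorem tripleInt_smul_mid (u : Loop) (r : ℝ) (v w : Loop) :
    tripleInt u (r • v) w = r * tripleInt u v w := by
  rw [← tripleInt_rotate w u, tripleInt_smul_right, tripleInt_rotate w u]

theorem tripleInt_add_left (u v w x : Loop) :
    tripleInt (u + v) w x = tripleInt u w x + tripleInt v w x := by
  rw [tripleInt_rotate, tripleInt_add_right, ← tripleInt_rotate u, ← tripleInt_rotate v]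

theorem tripleInt_smul_left (r : ℝ) (u v w : Loop) :
    tripleInt (r • u) v w = r * tripleInt u v w := by
  rw [tripleInt_rotate, tripleInt_smul_right, ← tripleInt_rotate u]

/-- Integration by parts over the circle. -/
theorem tripleInt_parts (u v w : Loop) :
    tripleInt (derivLoop u) v w + tripleInt u (derivLoop v) w + tripleInt u v (derivLoop w) = 0 := by
  have hd : ∀ θ, HasDerivAt (fun θ => triple (u.1 θ) (v.1 θ) (w.1 θ))
      (triple ((derivLoop u).1 θ) (v.1 θ) (w.1 θ) + triple (u.1 θ) ((derivLoop v).1 θ) (w.1 θ) +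
        triple (u.1 θ) (v.1 θ) ((derivLoop w).1 θ)) θ := by
    intro θ
    have h := ((((hasDerivAt_const θ crossCLM).clm_apply (u.differentiableAt θ).hasDerivAt).clm_apply
      (v.differentiableAt θ).hasDerivAt).inner ℝ (w.differentiableAt θ).hasDerivAt)
    refine h.congr_deriv ?_
    simp only [_root_.zero_apply, zero_add, crossCLM_apply, triple, inner_add_left,
      derivLoop_apply]
    ring
  have i1 := intervalIntegrable_triple (derivLoop u) v w
  have i2 := intervalIntegrable_triple u (derivLoop v) w
  have i3 := intervalIntegrable_triple u v (derivLoop w)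
  have h := intervalIntegral.integral_eq_sub_of_hasDerivAt (fun θ _ => hd θ) ((i1.add i2).add i3)
  rw [intervalIntegral.integral_add (i1.add i2) i3, intervalIntegral.integral_add i1 i2] at h
  have hp := triple_periodic u v w 0
  simp only [zero_add] at hp
  rw [tripleInt, tripleInt, tripleInt, h, hp, sub_self]

/-- The single θ-derivative contributes exactly the Jacobian φ' of the substitution. -/
theorem tripleInt_reparam (φ : DiffPlus) (u v w : Loop) :
    tripleInt (derivLoop (reparam φ u)) (reparam φ v) (reparam φ w) =
      tripleInt (derivLoop u) v w := by
  rw [tripleInt, tripleInt, ← circleIntegral_reparam φ (contDiff_triple (derivLoop u) v w).continuous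
    (triple_periodic (derivLoop u) v w)]
  refine intervalIntegral.integral_congr fun θ _ => ?_
  simp only [derivLoop_apply, deriv_reparam, reparam_apply, triple, cross_smul_left,
    real_inner_smul_left]
  ring

/-- Testing with w = u × v makes the integrand |u × v|². -/
theorem cross_eq_zero_of_tripleInt {u v : Loop} (h : ∀ w, tripleInt u v w = 0) (θ : ℝ) :
    cross (u.1 θ) (v.1 θ) = 0 := by
  let w : Loop := ⟨fun θ => crossCLM (u.1 θ) (v.1 θ),
    (contDiff_const.clm_apply u.contDiff).clm_apply v.contDiff, fun θ => by
      simp only [u.periodic θ, v.periodic θ]⟩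
  have h0 := eq_zero_of_circleIntegral_eq_zero (contDiff_triple u v w).continuous
    (triple_periodic u v w) (fun θ => by exact real_inner_self_nonneg) (h w) θ
  exact inner_self_eq_zero.1 h0

theorem contDiffOn_tripleInt {P : Type} [NormedAddCommGroup P] [NormedSpace ℝ P] {U : Set P}
    {u v w : P → Loop} (hu : IsPlot U u) (hv : IsPlot U v) (hw : IsPlot U w) :
    ContDiffOn ℝ ∞ (fun x => tripleInt (u x) (v x) (w x)) U :=
  contDiffOn_circleIntegral hu.1 (contDiffOn_triple hu.2 hv.2 hw.2)

/-! ### Vertical vectors -/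

theorem cross_eq_zero_of_mem_vert {c h : Loop} (hh : h ∈ vert c) (θ : ℝ) :
    cross (deriv c.1 θ) (h.1 θ) = 0 := by
  obtain ⟨a, -, -, he⟩ := hh
  rw [he, cross_smul_right, cross_same, smul_zero]

/-- The coefficient ⟨c', h⟩/⟨c', c'⟩ is smooth because c' has no zeros. -/
theorem mem_vert_of_cross_eq_zero {c : Loop} (hc : c ∈ Imm) {h : Loop}
    (hh : ∀ θ, cross (deriv c.1 θ) (h.1 θ) = 0) : h ∈ vert c := by
  have hd := (derivLoop c).contDiff
  refine ⟨fun θ => inner ℝ ((derivLoop c).1 θ) (h.1 θ) /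
    inner ℝ ((derivLoop c).1 θ) ((derivLoop c).1 θ), ?_, fun θ => ?_, fun θ => ?_⟩
  · have h1 : ContDiff ℝ ∞ (fun θ => (inner ℝ ((derivLoop c).1 θ) (h.1 θ) : ℝ)) :=
      hd.inner ℝ h.contDiff
    have h2 : ContDiff ℝ ∞ (fun θ => (inner ℝ ((derivLoop c).1 θ) ((derivLoop c).1 θ) : ℝ)) :=
      hd.inner ℝ hd
    exact h1.div h2 fun θ => inner_self_ne_zero.2 (hc θ)
  · simp only [(derivLoop c).periodic θ, h.periodic θ]
  · exact eq_smul_of_cross_eq_zero (hc θ) (hh θ)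

theorem tripleInt_vert {c h : Loop} (hh : h ∈ vert c) (w : Loop) :
    tripleInt (derivLoop c) h w = 0 := by
  have h0 : ∀ θ, triple ((derivLoop c).1 θ) (h.1 θ) (w.1 θ) = 0 := fun θ => by
    rw [triple, derivLoop_apply, cross_eq_zero_of_mem_vert hh, inner_zero_left]
  simp [tripleInt, h0]

/-- A field along `c` which is orthogonal to all vertical fields is pointwise orthogonal to `c'`. -/
theorem inner_deriv_eq_zero_of_metric {c : Loop} (hc : c ∈ Imm) {x : Loop}
    (hx : ∀ h ∈ vert c, metric idOp c x h = 0) (θ : ℝ) : inner ℝ (x.1 θ) (deriv c.1 θ) = 0 := by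
  have hd := (derivLoop c).contDiff
  have ha : ContDiff ℝ ∞ (fun θ => inner ℝ (x.1 θ) ((derivLoop c).1 θ)) := x.contDiff.inner ℝ hd
  have hap : Function.Periodic (fun θ => inner ℝ (x.1 θ) ((derivLoop c).1 θ)) (2 * Real.pi) :=
    fun θ => by simp only [x.periodic θ, (derivLoop c).periodic θ]
  -- This vertical test field turns the pairing into the integral of ⟨x, c'⟩² |c'|.
  let h : Loop := ⟨fun θ => (inner ℝ (x.1 θ) ((derivLoop c).1 θ) : ℝ) • (derivLoop c).1 θ,
    ha.smul hd, fun θ => by simp only [x.periodic θ, (derivLoop c).periodic θ]⟩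
  have h0 := hx h ⟨_, ha, hap, fun _ => rfl⟩
  have hfun : (fun θ => (inner ℝ (x.1 θ) (h.1 θ) : ℝ) * ‖deriv c.1 θ‖) = fun θ =>
      (inner ℝ (x.1 θ) ((derivLoop c).1 θ) : ℝ) ^ 2 * ‖(derivLoop c).1 θ‖ := by
    funext θ
    show (inner ℝ (x.1 θ) ((inner ℝ (x.1 θ) ((derivLoop c).1 θ) : ℝ) • (derivLoop c).1 θ) : ℝ) * _ = _
    rw [real_inner_smul_right, derivLoop_apply]
    ring
  have h1 := eq_zero_of_circleIntegral_eq_zero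
    (f := fun θ => (inner ℝ (x.1 θ) ((derivLoop c).1 θ) : ℝ) ^ 2 * ‖(derivLoop c).1 θ‖)
    ((ha.continuous.pow 2).mul hd.continuous.norm) (fun θ => by
      simp only [x.periodic θ, (derivLoop c).periodic θ]) (fun θ => by positivity)
    (by rw [← hfun]; exact h0) θ
  have h2 : ‖(derivLoop c).1 θ‖ ≠ 0 := norm_ne_zero_iff.2 (hc θ)
  exact pow_eq_zero_iff two_ne_zero |>.1 ((mul_eq_zero.1 h1).resolve_right h2)

/-- The derivative of a reparametrization invariant function vanishes on vertical vectors. -/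
theorem dirDeriv_vert {f : Loop → ℝ} (hf : IsSmoothFun f)
    (hinv : ∀ c ∈ Imm, ∀ φ : DiffPlus, f (reparam φ c) = f c) {c : Loop} (hc : c ∈ Imm) {h : Loop}
    (hh : h ∈ vert c) : dirDeriv f c h = 0 := by
  obtain ⟨a, ha, hap, he⟩ := hh
  have ha' : Continuous (deriv a) := ha.continuous_deriv (by simp)
  obtain ⟨C, hC⟩ := isCompact_Icc.exists_bound_of_continuousOn (s := Icc 0 (2 * Real.pi))
    ha'.continuousOn
  have hC' : ∀ θ, |deriv a θ| ≤ C := fun θ => by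
    obtain ⟨θ', hθ', e⟩ := (periodic_deriv hap).exists_mem_Ico₀ Real.two_pi_pos θ
    rw [e]
    exact hC θ' (Ico_subset_Icc_self hθ')
  have hC0 : 0 ≤ C := (abs_nonneg _).trans (hC' 0)
  -- With C bounding |a'|, |t| < ε gives |t a'| < 1, so θ ↦ θ + t a(θ) is a diffeomorphism. Its
  -- action moves c with initial velocity a c' = h, while f stays constant.
  set ε : ℝ := (C + 1)⁻¹ with hε
  have hε0 : 0 < ε := by positivity
  set U : Set ℝ := Ioo (-ε) ε
  have hda : ∀ θ, HasDerivAt a (deriv a θ) θ := fun θ =>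
    (ha.differentiable (by simp) θ).hasDerivAt
  have hdφ : ∀ t θ, HasDerivAt (fun θ => θ + t * a θ) (1 + t * deriv a θ) θ := fun t θ =>
    (hasDerivAt_id θ).add ((hda θ).const_mul t)
  have hpos : ∀ t ∈ U, ∀ θ, 0 < 1 + t * deriv a θ := fun t ht θ => by
    have h1 : |t * deriv a θ| < 1 := by
      rw [abs_mul]
      have h2 : |t| < ε := abs_lt.2 ht
      calc |t| * |deriv a θ| ≤ ε * C := mul_le_mul h2.le (hC' θ) (abs_nonneg _) hε0.le
        _ < ε * (C + 1) := by gcongr; linarith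
        _ = 1 := inv_mul_cancel₀ (by positivity)
    linarith [(abs_lt.1 h1).1]
  let φ : ∀ t ∈ U, DiffPlus := fun t ht =>
    { lift := fun θ => θ + t * a θ
      smooth := contDiff_id.add (contDiff_const.mul ha)
      deriv_pos := fun θ => by
        rw [(hdφ t θ).deriv]
        exact hpos t ht θ
      degree_one := fun θ => by
        rw [hap θ]
        ring }
  obtain ⟨hpl, hap'⟩ := isPlot_toLoop (U := U) (F := fun z : ℝ × ℝ => c.1 (z.2 + z.1 * a z.2))
    isOpen_Ioo (c.contDiff.comp (contDiff_snd.add (contDiff_fst.mul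
      (ha.comp contDiff_snd)))).contDiffOn (fun t ht θ => by
        simp only [hap θ]
        rw [add_right_comm, c.periodic])
  set γ : ℝ → Loop := fun t => toLoop (fun θ => c.1 (θ + t * a θ)) with hγ
  have h0 : (0 : ℝ) ∈ U := ⟨neg_lt_zero.2 hε0, hε0⟩
  have hγr : ∀ t (ht : t ∈ U), γ t = reparam (φ t ht) c := fun t ht => Loop.ext' fun θ => hap' t ht θ
  have hγ0 : γ 0 = c := Loop.ext' fun θ => by
    rw [hγ, hap' 0 h0 θ]
    simp
  have hv : IsVelocity γ 0 h := fun θ => by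
    have h1 : HasDerivAt (fun t : ℝ => θ + t * a θ) (a θ) 0 := by
      simpa using ((hasDerivAt_id (0 : ℝ)).mul_const (a θ)).const_add θ
    have h2 := HasDerivAt.scomp_of_eq (0 : ℝ) (c.differentiableAt θ).hasDerivAt h1 (by simp)
    rw [he θ]
    refine h2.congr_of_eventuallyEq ?_
    filter_upwards [isOpen_Ioo.mem_nhds h0] with t ht
    exact hap' t ht θ
  have hd := hf.hasDerivAt_comp hpl (fun t ht => (hγr t ht).symm ▸ reparam_mem_imm hc _) h0 hv
  rw [hγ0] at hd
  refine hd.unique ?_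
  refine (hasDerivAt_const (0 : ℝ) (f c)).congr_of_eventuallyEq ?_
  filter_upwards [isOpen_Ioo.mem_nhds h0] with t ht
  show f (γ t) = f c
  rw [hγr t ht, hinv c hc]

theorem dirDeriv_reparam {f : Loop → ℝ} (hinv : ∀ c ∈ Imm, ∀ φ : DiffPlus, f (reparam φ c) = f c)
    {c : Loop} (hc : c ∈ Imm) (φ : DiffPlus) (h : Loop) :
    dirDeriv f (reparam φ c) (reparam φ h) = dirDeriv f c h := by
  refine Filter.EventuallyEq.deriv_eq ?_
  filter_upwards [eventually_line hc h] with t ht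
  rw [← reparam_smul, ← reparam_add, hinv _ ht]

/-! ### The length functional -/

theorem length_pos {c : Loop} (hc : c ∈ Imm) : 0 < length c := by
  refine intervalIntegral.integral_pos Real.two_pi_pos
    (derivLoop c).continuous.norm.continuousOn (fun _ _ => norm_nonneg _) ⟨0, ?_, ?_⟩
  · exact ⟨le_rfl, Real.two_pi_pos.le⟩
  · exact norm_pos_iff.2 (hc 0)

theorem length_reparam (c : Loop) (φ : DiffPlus) : length (reparam φ c) = length c := by
  refine Eq.trans ?_ (circleIntegral_reparam φ (derivLoop c).continuous.norm
    fun θ => congrArg norm ((derivLoop c).periodic θ))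
  refine intervalIntegral.integral_congr fun θ _ => ?_
  simp only [deriv_reparam, norm_smul, Real.norm_eq_abs, abs_of_pos (φ.deriv_pos θ)]
  exact mul_comm _ _

theorem isSmoothFun_length : IsSmoothFun length := fun _ _ _ hγ =>
  contDiffOn_circleIntegral hγ.1.1 (hγ.1.deriv.2.norm ℝ fun z hz => hγ.2 z.1 hz.1 z.2)

theorem length_smul (r : ℝ) (c : Loop) : length (r • c) = |r| * length c := by
  rw [length, length, ← intervalIntegral.integral_const_mul]
  refine intervalIntegral.integral_congr fun θ _ => ?_
  simp only [← derivLoop_apply, map_smul, Loop.smul_apply, norm_smul, Real.norm_eq_abs]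

theorem dirDeriv_length_self (c : Loop) : dirDeriv length c c = length c := by
  have h1 : HasDerivAt (fun t : ℝ => (1 + t) * length c) (length c) 0 := by
    simpa using ((hasDerivAt_id (0 : ℝ)).const_add 1).mul_const (length c)
  refine (h1.congr_of_eventuallyEq ?_).deriv
  filter_upwards [Ioi_mem_nhds (show (-1 : ℝ) < 0 by norm_num)] with t ht
  have : c + t • c = (1 + t) • c := by module
  rw [this, length_smul, abs_of_pos (by linarith [mem_Ioi.1 ht])]

/-! ### Liouville forms and induced two-forms -/

/-- The speed in ds cancels the one in D_s. Where c' = 0 both integrands vanish, so the identity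
holds for all loops. -/
theorem liouville_id (c h : Loop) : liouville idOp c h = tripleInt c (derivLoop c) h := by
  refine intervalIntegral.integral_congr fun θ _ => ?_
  show (inner ℝ (cross (c.1 θ) (‖deriv c.1 θ‖⁻¹ • deriv c.1 θ)) (h.1 θ) : ℝ) * ‖deriv c.1 θ‖ =
    inner ℝ (cross (c.1 θ) (deriv c.1 θ)) (h.1 θ)
  rw [cross_smul_right, real_inner_smul_left]
  by_cases h0 : deriv c.1 θ = 0
  · rw [h0, ← zero_smul ℝ (0 : E3), cross_smul_right]
    simp
  · have := norm_ne_zero_iff.2 h0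
    field_simp

theorem liouville_id_rotate (c h : Loop) : liouville idOp c h = tripleInt (derivLoop c) h c := by
  rw [liouville_id, tripleInt_rotate]

theorem liouville_conformal (lam : Loop → ℝ) (c h : Loop) :
    liouville (conformal lam) c h = lam c * liouville idOp c h := by
  rw [liouville, liouville, ← intervalIntegral.integral_const_mul]
  refine intervalIntegral.integral_congr fun θ _ => ?_
  show (inner ℝ _ (lam c • h.1 θ) : ℝ) * _ = lam c * ((inner ℝ _ (h.1 θ) : ℝ) * _)
  rw [real_inner_smul_right, mul_assoc]

theorem marsdenWeinstein_eq (c h k : Loop) :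
    marsdenWeinstein c h k = tripleInt (derivLoop c) h k := by
  refine intervalIntegral.integral_congr fun θ _ => ?_
  show (inner ℝ (cross (‖deriv c.1 θ‖⁻¹ • deriv c.1 θ) (h.1 θ)) (k.1 θ) : ℝ) * ‖deriv c.1 θ‖ =
    inner ℝ (cross (deriv c.1 θ) (h.1 θ)) (k.1 θ)
  rw [cross_smul_left, real_inner_smul_left]
  by_cases h0 : deriv c.1 θ = 0
  · rw [h0, ← zero_smul ℝ (0 : E3), cross_smul_left]
    simp
  · have := norm_ne_zero_iff.2 h0
    field_simp

/-- Along c + t h the form is a quadratic polynomial in t, whose linear coefficient is read off. -/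
theorem dirDeriv_liouville_id (c h k : Loop) : dirDeriv (fun b => liouville idOp b k) c h =
    tripleInt h (derivLoop c) k + tripleInt c (derivLoop h) k := by
  set B := tripleInt h (derivLoop c) k + tripleInt c (derivLoop h) k with hB
  have hfun : (fun t : ℝ => liouville idOp (c + t • h) k) = fun t =>
      tripleInt c (derivLoop c) k + t * B + t ^ 2 * tripleInt h (derivLoop h) k := by
    funext t
    rw [liouville_id, map_add, map_smul, tripleInt_add_left, tripleInt_add_mid, tripleInt_add_mid,
      tripleInt_smul_left, tripleInt_smul_left, tripleInt_smul_mid, tripleInt_smul_mid, hB]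
    ring
  have hd : HasDerivAt (fun t : ℝ => tripleInt c (derivLoop c) k + t * B +
      t ^ 2 * tripleInt h (derivLoop h) k) B 0 := by
    have h1 := (((hasDerivAt_id (0 : ℝ)).mul_const B).const_add (tripleInt c (derivLoop c) k)).add
      ((hasDerivAt_pow 2 (0 : ℝ)).mul_const (tripleInt h (derivLoop h) k))
    exact h1.congr_deriv (by simp)
  rw [dirDeriv, hfun]
  exact hd.deriv

/-- The form `Ω^id` is three times the Marsden-Weinstein form. -/
theorem inducedForm_id (c h k : Loop) :
    inducedForm idOp c h k = 3 * tripleInt (derivLoop c) h k := by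
  rw [inducedForm, dOne, dirDeriv_liouville_id, dirDeriv_liouville_id]
  -- The antisymmetrized derivative contains T(c, h', k) and T(c, h, k'); integration by parts
  -- trades their sum for a third copy of T(c', h, k).
  have h1 := tripleInt_parts c h k
  have h2 := tripleInt_swap h (derivLoop c) k
  have h3 : tripleInt k (derivLoop c) h = tripleInt (derivLoop c) h k := tripleInt_rotate _ _ _
  have h4 : tripleInt c (derivLoop k) h = - tripleInt c h (derivLoop k) := by
    rw [tripleInt_rotate, tripleInt_swap, ← tripleInt_rotate c h]
  linarith

theorem contDiffOn_liouville_id {P : Type} [NormedAddCommGroup P] [NormedSpace ℝ P] {U : Set P}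
    {γ h : P → Loop} (hγ : IsPlot U γ) (hh : IsPlot U h) :
    ContDiffOn ℝ ∞ (fun x => liouville idOp (γ x) (h x)) U :=
  (contDiffOn_tripleInt hγ hγ.deriv hh).congr fun _ _ => liouville_id _ _

theorem isSmoothFun_liouville_id (k : Loop) : IsSmoothFun (fun c => liouville idOp c k) :=
  fun _ _ _ hγ => contDiffOn_liouville_id hγ.1 (isPlot_const hγ.1.1 k)

/-! ### The conformal operators L = λ id. -/

section Conformal

variable {lam : Loop → ℝ}

theorem isSmoothFun_liouville_conformal (hs : IsSmoothFun lam) (k : Loop) :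
    IsSmoothFun (fun c => liouville (conformal lam) c k) := fun _ _ _ hγ => by
  simp only [liouville_conformal]
  exact (hs.contDiffOn hγ.1 hγ.2).mul (contDiffOn_liouville_id hγ.1 (isPlot_const hγ.1.1 k))

theorem isSmoothOneForm_liouville_conformal (hs : IsSmoothFun lam) :
    IsSmoothOneForm (liouville (conformal lam)) := by
  refine ⟨fun c _ => ⟨fun h k => ?_, fun r h => ?_⟩, fun n U γ h hγ hh => ?_⟩
  · simp only [liouville_conformal, liouville_id, tripleInt_add_right, mul_add]
  · simp only [liouville_conformal, liouville_id, tripleInt_smul_right, smul_eq_mul]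
    ring
  · simp only [liouville_conformal]
    exact (hs.contDiffOn hγ.1 hγ.2).mul (contDiffOn_liouville_id hγ.1 hh)

/-- Product rule for d(λ Θ^id). This explicit form serves all later kernel computations. -/
theorem inducedForm_conformal (hs : IsSmoothFun lam) {c : Loop} (hc : c ∈ Imm) (h k : Loop) :
    inducedForm (conformal lam) c h k = lam c * (3 * tripleInt (derivLoop c) h k) +
      (tripleInt (derivLoop c) h c * dirDeriv lam c k -
        tripleInt (derivLoop c) k c * dirDeriv lam c h) := by
  have key : ∀ h k, dirDeriv (fun b => liouville (conformal lam) b k) c h =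
      dirDeriv lam c h * liouville idOp c k +
        lam c * dirDeriv (fun b => liouville idOp b k) c h := by
    intro h k
    have := ((hs.hasDerivAt_line hc h).mul ((isSmoothFun_liouville_id k).hasDerivAt_line hc h)).deriv
    simp only [zero_smul, add_zero] at this
    rw [← this, dirDeriv]
    simp only [liouville_conformal]
    rfl
  have h1 := inducedForm_id c h k
  rw [inducedForm, dOne] at h1
  rw [inducedForm, dOne, key, key, ← h1, liouville_id_rotate, liouville_id_rotate]
  ring

theorem inducedForm_conformal_eq_wedge (hs : IsSmoothFun lam) {c : Loop} (hc : c ∈ Imm)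
    (h k : Loop) : inducedForm (conformal lam) c h k =
      lam c * inducedForm idOp c h k + wedge (liouville idOp) (dirDeriv lam) c h k := by
  rw [inducedForm_conformal hs hc, inducedForm_id, wedge, liouville_id_rotate, liouville_id_rotate]

theorem isSmoothTwoForm_inducedForm (hs : IsSmoothFun lam) :
    IsSmoothTwoForm (inducedForm (conformal lam)) := by
  refine ⟨fun c hc => ⟨fun k => ⟨fun h₁ h₂ => ?_, fun r h => ?_⟩,
    fun h => ⟨fun k₁ k₂ => ?_, fun r k => ?_⟩, fun h => ?_⟩, fun n U γ h k hγ hh hk => ?_⟩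
  · simp only [inducedForm_conformal hs hc, tripleInt_add_mid, (hs.dirDeriv_linear hc).map_add]
    ring
  · simp only [inducedForm_conformal hs hc, tripleInt_smul_mid, (hs.dirDeriv_linear hc).map_smul,
      smul_eq_mul]
    ring
  · simp only [inducedForm_conformal hs hc, tripleInt_add_right, tripleInt_add_mid,
      (hs.dirDeriv_linear hc).map_add]
    ring
  · simp only [inducedForm_conformal hs hc, tripleInt_smul_right, tripleInt_smul_mid,
      (hs.dirDeriv_linear hc).map_smul, smul_eq_mul]
    ring
  · rw [inducedForm_conformal hs hc, tripleInt_self_right]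
    ring
  · refine ContDiffOn.congr ?_ fun x hx => inducedForm_conformal hs (hγ.2 x hx) (h x) (k x)
    have hd := hγ.1.deriv
    exact ((hs.contDiffOn hγ.1 hγ.2).mul (contDiffOn_const.mul (contDiffOn_tripleInt hd hh hk))).add
      (((contDiffOn_tripleInt hd hh hγ.1).mul (hs.contDiffOn_dirDeriv hγ.1 hγ.2 hk)).sub
        ((contDiffOn_tripleInt hd hk hγ.1).mul (hs.contDiffOn_dirDeriv hγ.1 hγ.2 hh)))

theorem isClosedTwoForm_inducedForm (hs : IsSmoothFun lam) :
    IsClosedTwoForm (inducedForm (conformal lam)) :=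
  isClosedTwoForm_neg_dOne (isSmoothFun_liouville_conformal hs)

theorem inducedForm_reparam (hs : IsSmoothFun lam)
    (hinv : ∀ c ∈ Imm, ∀ φ : DiffPlus, lam (reparam φ c) = lam c) {c : Loop} (hc : c ∈ Imm)
    (φ : DiffPlus) (h k : Loop) :
    inducedForm (conformal lam) (reparam φ c) (reparam φ h) (reparam φ k) =
      inducedForm (conformal lam) c h k := by
  rw [inducedForm_conformal hs hc, inducedForm_conformal hs (reparam_mem_imm hc φ),
    tripleInt_reparam, tripleInt_reparam, tripleInt_reparam, hinv c hc, dirDeriv_reparam hinv hc,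
    dirDeriv_reparam hinv hc]

theorem inducedForm_vert (hs : IsSmoothFun lam)
    (hinv : ∀ c ∈ Imm, ∀ φ : DiffPlus, lam (reparam φ c) = lam c) {c : Loop} (hc : c ∈ Imm)
    {h : Loop} (hh : h ∈ vert c) (k : Loop) : inducedForm (conformal lam) c h k = 0 := by
  rw [inducedForm_conformal hs hc, tripleInt_vert hh, tripleInt_vert hh,
    dirDeriv_vert hs hinv hc hh]
  ring

/-- Contraction with the scaling field isolates 3λ + D_{c,c}λ, the quantity that separates cases (a)
and (b). -/
theorem inducedForm_self_right (hs : IsSmoothFun lam) {c : Loop} (hc : c ∈ Imm) (h : Loop) :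
    inducedForm (conformal lam) c h c = scaleDefect lam c * tripleInt (derivLoop c) h c := by
  rw [inducedForm_conformal hs hc, tripleInt_self_right, scaleDefect]
  ring

/-- Where `3 λ + D_{c,c} λ ≠ 0`, the kernel of `Ω^λ` is vertical. -/
theorem mem_vert_of_inducedForm_eq_zero (hpos : ∀ c ∈ Imm, 0 < lam c) (hs : IsSmoothFun lam)
    (hinv : ∀ c ∈ Imm, ∀ φ : DiffPlus, lam (reparam φ c) = lam c) {c : Loop} (hc : c ∈ Imm)
    (hdef : scaleDefect lam c ≠ 0) {h : Loop}
    (hh : ∀ k, inducedForm (conformal lam) c h k = 0) : h ∈ vert c := by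
  have h1 := hh c
  rw [inducedForm_self_right hs hc] at h1
  have hΘ : tripleInt (derivLoop c) h c = 0 := (mul_eq_zero.1 h1).resolve_left hdef
  -- Once T(c', h, c) = 0, the kernel equation reads T(c', 3λh + dλ(h)c, w) = 0 for all w.
  have hv : (3 * lam c) • h + dirDeriv lam c h • c ∈ vert c := by
    refine mem_vert_of_cross_eq_zero hc (cross_eq_zero_of_tripleInt (u := derivLoop c) fun w => ?_)
    have h2 := hh w
    rw [inducedForm_conformal hs hc, hΘ] at h2
    rw [tripleInt_add_mid, tripleInt_smul_mid, tripleInt_smul_mid]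
    have h3 : tripleInt (derivLoop c) c w = - tripleInt (derivLoop c) w c := by
      rw [tripleInt_rotate, tripleInt_swap, ← tripleInt_rotate (derivLoop c) w c]
    rw [h3]
    linarith
  -- Applying dλ to this vertical vector gives dλ(h)(3λ + dλ(c)) = 0.
  have h4 := dirDeriv_vert hs hinv hc hv
  rw [(hs.dirDeriv_linear hc).map_add, (hs.dirDeriv_linear hc).map_smul,
    (hs.dirDeriv_linear hc).map_smul] at h4
  have h5 : dirDeriv lam c h * scaleDefect lam c = 0 := by
    rw [scaleDefect, ← h4]
    simp only [smul_eq_mul]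
    ring
  rw [(mul_eq_zero.1 h5).resolve_right hdef, zero_smul, add_zero] at hv
  have h6 := (hpos c hc).ne'
  have := (vert c).smul_mem (3 * lam c)⁻¹ hv
  rwa [smul_smul, inv_mul_cancel₀ (mul_ne_zero three_ne_zero h6), one_smul] at this

theorem isSmoothFun_scaleDefect (hs : IsSmoothFun lam) : IsSmoothFun (scaleDefect lam) :=
  fun _ _ _ hγ => (contDiffOn_const.mul (hs.contDiffOn hγ.1 hγ.2)).add
    (hs.contDiffOn_dirDeriv hγ.1 hγ.2 hγ.1)

end Conformal

theorem isOpenInImm_ne {f : Loop → ℝ} (hf : IsSmoothFun f) :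
    IsOpenInImm {c | c ∈ Imm ∧ f c ≠ 0} := by
  refine ⟨fun c hc => hc.1, fun n U γ hγ => ?_⟩
  have h1 := (hf n U γ hγ).continuousOn.isOpen_inter_preimage hγ.1.1
    (isOpen_compl_singleton (x := (0 : ℝ)))
  rwa [show U ∩ γ ⁻¹' {c | c ∈ Imm ∧ f c ≠ 0} = U ∩ (fun x => f (γ x)) ⁻¹' {0}ᶜ from
    Set.ext fun x => ⟨fun hx => ⟨hx.1, hx.2.2⟩, fun hx => ⟨hx.1, hγ.2 x hx.1, hx.2⟩⟩]

/-- A smooth vector field which is vertical on a dense set is vertical. -/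
theorem IsSmoothField.mem_vert_of_dense {Y : Loop → Loop} (hY : IsSmoothField Y)
    (hd : ∀ V : Set Loop, IsOpenInImm V → V.Nonempty → ∃ c ∈ V, Y c ∈ vert c) {c : Loop}
    (hc : c ∈ Imm) : Y c ∈ vert c := by
  refine mem_vert_of_cross_eq_zero hc fun θ => ?_
  by_contra hne
  -- For fixed θ this is a smooth function of the curve, so its non-vanishing set is open and would
  -- have to meet the dense set where Y is vertical.
  set f : Loop → ℝ := fun b => ‖crossCLM ((derivLoop b).1 θ) ((Y b).1 θ)‖ ^ 2 with hfdef
  have hf : IsSmoothFun f := by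
    intro n U γ hγ
    have slice : ∀ {δ : EuclideanSpace ℝ (Fin n) → Loop}, IsPlot U δ →
        ContDiffOn ℝ ∞ (fun x => (δ x).1 θ) U := fun hδ =>
      hδ.2.comp (f := fun x => (x, θ)) (by fun_prop) fun x hx => ⟨hx, trivial⟩
    exact ((contDiffOn_const.clm_apply (slice hγ.1.deriv)).clm_apply
      (slice (hY n U γ hγ))).norm_sq ℝ
  obtain ⟨b, ⟨-, hb⟩, hv⟩ := hd _ (isOpenInImm_ne hf)
    ⟨c, hc, pow_ne_zero 2 (norm_ne_zero_iff.2 hne)⟩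
  refine hb ?_
  rw [hfdef]
  simp only [crossCLM_apply, derivLoop_apply, cross_eq_zero_of_mem_vert hv]
  simp

/-! ### Forms on quotients -/

/-- A form that kills the fibre directions in the first slot kills them in the second by
skew-symmetry, so it descends to the quotient. The Lie derivative condition of `Induces` is supplied
separately. -/
theorem exists_quotientForm {M : Set Loop} {D : Loop → Submodule ℝ Loop}
    {Ω : Loop → Loop → Loop → ℝ} (hΩ : IsSmoothTwoForm Ω) (hM : M ⊆ Imm)
    (hinv : ∀ c ∈ Imm, ∀ (φ : DiffPlus) (h k : Loop),
      Ω (reparam φ c) (reparam φ h) (reparam φ k) = Ω c h k)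
    (hfib : ∀ c ∈ M, fibreTangent D c ≤ tangentSpace M c)
    (hker : ∀ c ∈ M, ∀ h ∈ fibreTangent D c, ∀ k, Ω c h k = 0) :
    ∃ η : QuotientForm M D, ∀ (c : M) (h k : tangentSpace M c.1),
      η.form c (tangentClass M D c.1 h) (tangentClass M D c.1 k) = Ω c.1 h.1 k.1 := by
  let B : ∀ c : M, tangentSpace M c.1 →ₗ[ℝ] tangentSpace M c.1 →ₗ[ℝ] ℝ := fun c =>
    LinearMap.mk₂ ℝ (fun h k => Ω c.1 h.1 k.1)
      (fun _ _ k => ((hΩ.1 c.1 (hM c.2)).1 k.1).map_add _ _)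
      (fun _ _ k => ((hΩ.1 c.1 (hM c.2)).1 k.1).map_smul _ _)
      (fun h _ _ => ((hΩ.1 c.1 (hM c.2)).2.1 h.1).map_add _ _)
      (fun _ h _ => ((hΩ.1 c.1 (hM c.2)).2.1 h.1).map_smul _ _)
  have hB1 : ∀ c : M, (fibreTangent D c.1).submoduleOf (tangentSpace M c.1) ≤ (B c).ker :=
    fun c h hh => LinearMap.ext fun k => hker c.1 c.2 h.1 hh k.1
  have hB2 : ∀ c : M, (fibreTangent D c.1).submoduleOf (tangentSpace M c.1) ≤ (B c).flip.ker :=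
    fun c k hk => LinearMap.ext fun h => by
      show Ω c.1 h.1 k.1 = 0
      rw [hΩ.swap (hM c.2), hker c.1 c.2 k.1 hk, neg_zero]
  refine ⟨⟨fun c => hfib c.1 c.2, fun c => (B c).liftQ₂ _ _ (hB1 c) (hB2 c), ?_, ?_⟩,
    fun c h k => rfl⟩
  · intro c u
    obtain ⟨h, rfl⟩ := Submodule.Quotient.mk_surjective _ u
    exact (hΩ.1 c.1 (hM c.2)).2.2 h.1
  · intro φ b c h k h₁ k₁ hc hh hk
    show Ω c.1 h₁.1 k₁.1 = Ω b.1 h.1 k.1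
    rw [hh, hk, hc, hinv b.1 (hM b.2)]

theorem QuotientForm.nondegenerateAt_of {M : Set Loop} {D : Loop → Submodule ℝ Loop}
    {Ω : Loop → Loop → Loop → ℝ} {η : QuotientForm M D}
    (hη : ∀ (c : M) (h k : tangentSpace M c.1),
      η.form c (tangentClass M D c.1 h) (tangentClass M D c.1 k) = Ω c.1 h.1 k.1) {c : M}
    (hnd : ∀ h ∈ tangentSpace M c.1, (∀ k ∈ tangentSpace M c.1, Ω c.1 h k = 0) →
      h ∈ fibreTangent D c.1) : η.NondegenerateAt c := by
  rw [QuotientForm.NondegenerateAt, injective_iff_map_eq_zero]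
  intro u hu
  obtain ⟨h, rfl⟩ := Submodule.Quotient.mk_surjective _ u
  rw [Submodule.Quotient.mk_eq_zero]
  refine hnd h.1 h.2 fun k hk => ?_
  rw [← hη c h ⟨k, hk⟩]
  exact LinearMap.congr_fun hu _

/-! ### Tangent spaces of level sets -/

theorem mem_tangentSpace_of_path {M : Set Loop} {U : Set ℝ} {γ : ℝ → Loop} (hγ : IsPlot U γ)
    (h0 : (0 : ℝ) ∈ U) (hM : ∀ t ∈ U, γ t ∈ M) {h : Loop} (hv : IsVelocity γ 0 h) :
    h ∈ tangentSpace M (γ 0) := by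
  obtain ⟨ε, hε, hb⟩ := Metric.isOpen_iff.1 hγ.1 0 h0
  have hb' : Ioo (-ε) ε ⊆ U := by
    rw [Real.ball_eq_Ioo] at hb
    simpa using hb
  exact Submodule.subset_span ⟨γ, ε, hε, hγ.mono isOpen_Ioo hb', fun t ht => hM t (hb' ht), rfl, hv⟩

theorem tangentSpace_imm {c : Loop} (hc : c ∈ Imm) : tangentSpace Imm c = ⊤ := by
  refine eq_top_iff.2 fun h _ => ?_
  have := mem_tangentSpace_of_path (isPlot_line_imm c h) (zero_mem_line hc h) (fun _ ht => ht)
    (isVelocity_line c h 0)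
  simp only [zero_smul, add_zero] at this
  exact this

theorem tangentSpace_le_dirDeriv {M : Set Loop} (hM : M ⊆ Imm) {f : Loop → ℝ} (hf : IsSmoothFun f)
    (hconst : ∀ c ∈ M, f c = 1) {c h : Loop} (hc : c ∈ Imm) (hh : h ∈ tangentSpace M c) :
    dirDeriv f c h = 0 := by
  have hle : tangentSpace M c ≤ ((hf.dirDeriv_linear hc).mk' _).ker := by
    refine Submodule.span_le.2 ?_
    rintro h ⟨γ, ε, hε, hγ, hγM, rfl, hv⟩
    have h0 : (0 : ℝ) ∈ Ioo (-ε) ε := ⟨neg_lt_zero.2 hε, hε⟩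
    refine (hf.hasDerivAt_comp hγ (fun t ht => hM (hγM t ht)) h0 hv).unique ?_
    refine (hasDerivAt_const (0 : ℝ) (1 : ℝ)).congr_of_eventuallyEq ?_
    filter_upwards [isOpen_Ioo.mem_nhds h0] with t ht
    exact hconst _ (hγM t ht)
  exact hle hh

/-! ### Homogeneous functions -/

theorem exp_smul_mem_imm {c : Loop} (hc : c ∈ Imm) (t : ℝ) : Real.exp t • c ∈ Imm :=
  smul_mem_imm hc (Real.exp_pos t).ne'

theorem isPlot_exp_smul (c : Loop) (s : ℝ) : IsPlot univ (fun t : ℝ => Real.exp (t * s) • c) :=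
  (isPlot_const isOpen_univ c).smul (by fun_prop)

theorem isVelocity_exp_smul (c : Loop) (s t : ℝ) :
    IsVelocity (fun t : ℝ => Real.exp (t * s) • c) t (s • (Real.exp (t * s) • c)) := fun θ => by
  have h1 : HasDerivAt (fun t : ℝ => Real.exp (t * s)) (Real.exp (t * s) * s) t := by
    simpa using ((hasDerivAt_id t).mul_const s).exp
  refine (h1.smul_const (c.1 θ)).congr_deriv ?_
  rw [Loop.smul_apply, Loop.smul_apply, smul_smul, mul_comm]

/-- A positive, reparametrization invariant smooth function on the space of immersions which
is homogeneous of degree `m ≠ 0` under scalings, as expressed by Euler's identity. -/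
structure IsHomogeneousFun (f : Loop → ℝ) (m : ℝ) : Prop where
  smooth : IsSmoothFun f
  pos : ∀ c ∈ Imm, 0 < f c
  inv : ∀ c ∈ Imm, ∀ φ : DiffPlus, f (reparam φ c) = f c
  degree_ne : m ≠ 0
  euler : ∀ c ∈ Imm, dirDeriv f c c = m * f c

theorem isHomogeneousFun_length : IsHomogeneousFun length 1 where
  smooth := isSmoothFun_length
  pos _ hc := length_pos hc
  inv c _ φ := length_reparam c φ
  degree_ne := one_ne_zero
  euler c _ := by rw [dirDeriv_length_self, one_mul]

/-- The rescaling of a curve to the level set `{f = 1}` of a homogeneous function of degree `m`. -/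
noncomputable def rescale (f : Loop → ℝ) (m : ℝ) (c : Loop) : Loop :=
  Real.exp (-(Real.log (f c) / m)) • c

/-- The projection of a vector field along the scaling field to the level sets of a homogeneous
function of degree `m`. -/
noncomputable def levelProj (f : Loop → ℝ) (m : ℝ) (X : Loop → Loop) (c : Loop) : Loop :=
  X c - (dirDeriv f c (X c) / (m * f c)) • c

namespace IsHomogeneousFun

variable {f : Loop → ℝ} {m : ℝ}

/-- Euler's identity integrated along the scaling orbit: exp(-mt) f(exp(t) c) has zero derivative.
-/
theorem map_exp_smul (hf : IsHomogeneousFun f m) {c : Loop} (hc : c ∈ Imm) (t : ℝ) :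
    f (Real.exp t • c) = Real.exp (m * t) * f c := by
  have hd : ∀ t : ℝ, HasDerivAt (fun t : ℝ => Real.exp (-(m * t)) * f (Real.exp (t * 1) • c)) 0 t := by
    intro t
    have h1 := hf.smooth.hasDerivAt_comp (isPlot_exp_smul c 1)
      (fun t _ => exp_smul_mem_imm hc (t * 1)) (mem_univ t) (isVelocity_exp_smul c 1 t)
    rw [one_smul, hf.euler _ (exp_smul_mem_imm hc _)] at h1
    have h2 : HasDerivAt (fun t : ℝ => Real.exp (-(m * t))) (Real.exp (-(m * t)) * -m) t := by
      simpa using ((hasDerivAt_id t).const_mul m).neg.exp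
    exact (h2.mul h1).congr_deriv (by ring)
  have h3 := is_const_of_deriv_eq_zero (fun t => (hd t).differentiableAt) (fun t => (hd t).deriv) t 0
  simp only [mul_one, mul_zero, neg_zero, Real.exp_zero, one_mul, one_smul] at h3
  rw [← h3, ← mul_assoc, ← Real.exp_add]
  simp

/-- From exp(t) c + s k = exp(t)(c + s exp(-t) k): the derivative has degree m - 1. -/
theorem dirDeriv_exp_smul (hf : IsHomogeneousFun f m) {c : Loop} (hc : c ∈ Imm) (t : ℝ)
    (k : Loop) : dirDeriv f (Real.exp t • c) k = Real.exp ((m - 1) * t) * dirDeriv f c k := by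
  have h1 : HasDerivAt (fun s : ℝ => f (c + s • Real.exp (-t) • k))
      (Real.exp (-t) * dirDeriv f c k) 0 := by
    have := hf.smooth.hasDerivAt_line hc (Real.exp (-t) • k)
    rwa [(hf.smooth.dirDeriv_linear hc).map_smul] at this
  have h2 := h1.const_mul (Real.exp (m * t))
  have h3 : Real.exp (m * t) * (Real.exp (-t) * dirDeriv f c k) =
      Real.exp ((m - 1) * t) * dirDeriv f c k := by
    rw [← mul_assoc, ← Real.exp_add]
    ring_nf
  rw [h3] at h2
  refine (h2.congr_of_eventuallyEq ?_).deriv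
  filter_upwards [eventually_line hc (Real.exp (-t) • k)] with s hs
  rw [← hf.map_exp_smul hs]
  congr 1
  rw [smul_add, smul_comm s, smul_smul, ← Real.exp_add]
  simp

theorem rescale_mem (hf : IsHomogeneousFun f m) {c : Loop} (hc : c ∈ Imm) :
    rescale f m c ∈ levelOne f := by
  refine ⟨exp_smul_mem_imm hc _, ?_⟩
  rw [rescale, hf.map_exp_smul hc, mul_neg, mul_div_cancel₀ _ hf.degree_ne, Real.exp_neg,
    Real.exp_log (hf.pos c hc), inv_mul_cancel₀ (hf.pos c hc).ne']

theorem rescale_eq_self {c : Loop} (hc : f c = 1) : rescale f m c = c := by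
  simp [rescale, hc]

theorem rescale_reparam (hf : IsHomogeneousFun f m) {c : Loop} (hc : c ∈ Imm) (φ : DiffPlus) :
    rescale f m (reparam φ c) = reparam φ (rescale f m c) := by
  rw [rescale, rescale, hf.inv c hc, reparam_smul]

theorem isPlot_rescale (hf : IsHomogeneousFun f m) {P : Type*} [NormedAddCommGroup P]
    [NormedSpace ℝ P] [FiniteDimensional ℝ P] {U : Set P} {γ : P → Loop} (hγ : IsPlot U γ)
    (hI : ∀ x ∈ U, γ x ∈ Imm) : IsPlot U (fun x => rescale f m (γ x)) :=
  hγ.smul (((hf.smooth.contDiffOn hγ hI).log fun x hx => (hf.pos _ (hI x hx)).ne').div_const m).neg.exp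

/-- Differentiating the factor f^(-1/m) subtracts the scaling component: up to a positive factor the
velocity is projected along c to the kernel of df, as in `levelProj`. -/
theorem isVelocity_rescale (hf : IsHomogeneousFun f m) {U : Set ℝ} {γ : ℝ → Loop}
    (hγ : IsPlot U γ) (hI : ∀ t ∈ U, γ t ∈ Imm) {t : ℝ} (ht : t ∈ U) {h : Loop}
    (hv : IsVelocity γ t h) :
    IsVelocity (fun s => rescale f m (γ s)) t (Real.exp (-(Real.log (f (γ t)) / m)) •
      (h - (dirDeriv f (γ t) h / (m * f (γ t))) • γ t)) := by
  have h1 := hf.smooth.hasDerivAt_comp hγ hI ht hv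
  have h2 : HasDerivAt (fun s => Real.exp (-(Real.log (f (γ s)) / m)))
      (Real.exp (-(Real.log (f (γ t)) / m)) * -(dirDeriv f (γ t) h / f (γ t) / m)) t :=
    ((h1.log (hf.pos _ (hI t ht)).ne').div_const m).neg.exp
  refine (congrArg (IsVelocity _ t) ?_).mp (hv.smul h2)
  have := (hf.pos _ (hI t ht)).ne'
  have := hf.degree_ne
  rw [smul_sub, smul_smul, sub_eq_add_neg, ← neg_smul]
  congr 2
  field_simp

/-- The tangent space of the level set of a homogeneous function. -/
theorem mem_tangentSpace_iff (hf : IsHomogeneousFun f m) {c : Loop} (hc : c ∈ levelOne f)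
    {h : Loop} : h ∈ tangentSpace (levelOne f) c ↔ dirDeriv f c h = 0 := by
  refine ⟨fun hh => tangentSpace_le_dirDeriv (fun _ hb => hb.1) hf.smooth (fun _ hb => hb.2) hc.1 hh,
    fun hh => ?_⟩
  -- For h in the kernel of df, the line c + t h rescaled to {f = 1} still has initial velocity h.
  have h0 := zero_mem_line hc.1 h
  have hv := hf.isVelocity_rescale (isPlot_line_imm c h) (fun _ ht => ht) h0 (isVelocity_line c h 0)
  have hpl := hf.isPlot_rescale (isPlot_line_imm c h) fun _ ht => ht
  have := mem_tangentSpace_of_path (M := levelOne f) hpl h0 (fun _ ht => hf.rescale_mem ht) hv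
  simp only [zero_smul, add_zero, hh, zero_div, hc.2, Real.log_one, neg_zero, Real.exp_zero,
    one_smul, sub_zero, rescale_eq_self hc.2] at this
  exact this

theorem dirDeriv_levelProj (hf : IsHomogeneousFun f m) (X : Loop → Loop) {c : Loop}
    (hc : c ∈ Imm) : dirDeriv f c (levelProj f m X c) = 0 := by
  have hl := hf.smooth.dirDeriv_linear hc
  rw [levelProj, hl.map_sub, hl.map_smul, hf.euler c hc, smul_eq_mul,
    div_mul_cancel₀ _ (mul_ne_zero hf.degree_ne (hf.pos c hc).ne'), sub_self]

theorem levelProj_exp_smul (hf : IsHomogeneousFun f m) {X : Loop → Loop} {n : ℝ}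
    (hX : ∀ c ∈ Imm, ∀ t : ℝ, X (Real.exp t • c) = Real.exp (n * t) • X c) {c : Loop}
    (hc : c ∈ Imm) (t : ℝ) :
    levelProj f m X (Real.exp t • c) = Real.exp (n * t) • levelProj f m X c := by
  have hl := hf.smooth.dirDeriv_linear hc
  have h1 := (hf.pos c hc).ne'
  have h2 := hf.degree_ne
  rw [levelProj, levelProj, hX c hc, hf.dirDeriv_exp_smul hc, hf.map_exp_smul hc, hl.map_smul,
    smul_sub, smul_smul, smul_smul, smul_eq_mul]
  congr 2
  have h3 : Real.exp (m * t) = Real.exp ((m - 1) * t) * Real.exp t := by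
    rw [← Real.exp_add]
    ring_nf
  rw [h3]
  field_simp

end IsHomogeneousFun

/-! ### Level sets as slices for the scaling action -/

theorem mem_fibreTangent_scalingDist {X : Loop → Loop} {c h : Loop} :
    h ∈ fibreTangent (scalingDist X) c ↔
      ∃ v ∈ vert c, ∃ r s : ℝ, h = v + (r • c + s • X c) := by
  rw [fibreTangent, Submodule.mem_sup]
  constructor
  · rintro ⟨v, hv, w, hw, rfl⟩
    obtain ⟨r, s, rfl⟩ := Submodule.mem_span_pair.1 hw
    exact ⟨v, hv, r, s, rfl⟩
  · rintro ⟨v, hv, r, s, rfl⟩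
    exact ⟨v, hv, _, Submodule.mem_span_pair.2 ⟨r, s, rfl⟩, rfl⟩

theorem mem_fibreTangent_lineDist {Z : Loop → Loop} {c h : Loop} :
    h ∈ fibreTangent (lineDist Z) c ↔ ∃ v ∈ vert c, ∃ s : ℝ, h = v + s • Z c := by
  rw [fibreTangent, Submodule.mem_sup]
  constructor
  · rintro ⟨v, hv, w, hw, rfl⟩
    obtain ⟨s, rfl⟩ := Submodule.mem_span_singleton.1 hw
    exact ⟨v, hv, s, rfl⟩
  · rintro ⟨v, hv, s, rfl⟩
    exact ⟨v, hv, _, Submodule.mem_span_singleton.2 ⟨s, rfl⟩, rfl⟩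

section Slice

variable {f : Loop → ℝ} {m n : ℝ} {X Z : Loop → Loop}

theorem lineDist_le_scalingDist (hZ : ∀ c ∈ Imm, Z c = levelProj f m X c) {c : Loop}
    (hc : c ∈ Imm) : lineDist Z c ≤ scalingDist X c := by
  rw [lineDist, Submodule.span_singleton_le_iff_mem, hZ c hc]
  exact Submodule.sub_mem _ (Submodule.subset_span (by simp))
    (Submodule.smul_mem _ _ (Submodule.subset_span (by simp [scalingField])))

theorem IsHomogeneousFun.fibreTangent_le (hf : IsHomogeneousFun f m)
    (hZ : ∀ c ∈ Imm, Z c = levelProj f m X c) {c : Loop} (hc : c ∈ levelOne f) :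
    fibreTangent (lineDist Z) c ≤ tangentSpace (levelOne f) c := by
  intro h hh
  obtain ⟨v, hv, s, rfl⟩ := mem_fibreTangent_lineDist.1 hh
  have hl := hf.smooth.dirDeriv_linear hc.1
  rw [hf.mem_tangentSpace_iff hc, hl.map_add, hl.map_smul, dirDeriv_vert hf.smooth hf.inv hc.1 hv,
    hZ c hc.1, hf.dirDeriv_levelProj X hc.1, smul_zero, add_zero]

theorem IsHomogeneousFun.tangentSpace_inf (hf : IsHomogeneousFun f m)
    (hZ : ∀ c ∈ Imm, Z c = levelProj f m X c) {c : Loop} (hc : c ∈ levelOne f) :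
    tangentSpace (levelOne f) c ⊓ fibreTangent (scalingDist X) c = fibreTangent (lineDist Z) c := by
  refine le_antisymm ?_ (le_inf (hf.fibreTangent_le hZ hc)
    (sup_le_sup le_rfl (lineDist_le_scalingDist hZ hc.1)))
  rintro h ⟨h1, h2⟩
  obtain ⟨v, hv, r, s, rfl⟩ := mem_fibreTangent_scalingDist.1 h2
  have hl := hf.smooth.dirDeriv_linear hc.1
  have h3 := (hf.mem_tangentSpace_iff hc).1 h1
  rw [hl.map_add, hl.map_add, hl.map_smul, hl.map_smul, dirDeriv_vert hf.smooth hf.inv hc.1 hv,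
    hf.euler c hc.1, hc.2, zero_add, smul_eq_mul, smul_eq_mul, mul_one] at h3
  refine mem_fibreTangent_lineDist.2 ⟨v, hv, s, ?_⟩
  -- Tangency to {f = 1} determines the scaling coefficient, leaving a multiple of the projected
  -- field.
  have h4 : r = - (s * (dirDeriv f c (X c) / m)) := by
    have := hf.degree_ne
    field_simp
    linarith
  rw [hZ c hc.1, levelProj, hc.2, mul_one, h4]
  module

theorem IsHomogeneousFun.exists_tangent_add_smul (hf : IsHomogeneousFun f m) {c : Loop}
    (hc : c ∈ levelOne f) (h : Loop) :
    h - (dirDeriv f c h / m) • c ∈ tangentSpace (levelOne f) c := by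
  have hl := hf.smooth.dirDeriv_linear hc.1
  rw [hf.mem_tangentSpace_iff hc, hl.map_sub, hl.map_smul, hf.euler c hc.1, hc.2, mul_one,
    smul_eq_mul, div_mul_cancel₀ _ hf.degree_ne, sub_self]

theorem IsHomogeneousFun.tangentSpace_sup (hf : IsHomogeneousFun f m) {c : Loop}
    (hc : c ∈ levelOne f) :
    tangentSpace (levelOne f) c ⊔ fibreTangent (scalingDist X) c = ⊤ := by
  refine eq_top_iff.2 fun h _ => ?_
  rw [← sub_add_cancel h ((dirDeriv f c h / m) • c)]
  refine Submodule.add_mem_sup (hf.exists_tangent_add_smul hc h) ?_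
  exact mem_fibreTangent_scalingDist.2 ⟨0, Submodule.zero_mem _, dirDeriv f c h / m, 0, by simp⟩

theorem leafStep_inclusion (hZ : ∀ c ∈ Imm, Z c = levelProj f m X c) {b c : levelOne f}
    (h : leafStep (levelOne f) (lineDist Z) b c) :
    leafStep Imm (scalingDist X) ⟨b.1, b.2.1⟩ ⟨c.1, c.2.1⟩ := by
  rcases h with h | ⟨γ, hγ, hM, hv, h0, h1⟩
  · exact Or.inl h
  · refine Or.inr ⟨γ, hγ, fun t => (hM t).1, fun t => ?_, h0, h1⟩
    obtain ⟨h, hh, hv⟩ := hv t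
    exact ⟨h, lineDist_le_scalingDist hZ (hM t).1 hh, hv⟩

/-- Rescaling commutes with reparametrization. On a path tangent to the distribution it removes the
scaling component; homogeneity of X makes the projected field at γ t a multiple of Z at the rescaled
curve. -/
theorem IsHomogeneousFun.leafStep_rescale (hf : IsHomogeneousFun f m)
    (hZ : ∀ c ∈ Imm, Z c = levelProj f m X c)
    (hX : ∀ c ∈ Imm, ∀ t : ℝ, X (Real.exp t • c) = Real.exp (n * t) • X c) {b c : Imm}
    (h : leafStep Imm (scalingDist X) b c) :
    leafStep (levelOne f) (lineDist Z) ⟨rescale f m b.1, hf.rescale_mem b.2⟩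
      ⟨rescale f m c.1, hf.rescale_mem c.2⟩ := by
  rcases h with ⟨φ, hφ⟩ | ⟨γ, hγ, hM, hv, h0, h1⟩
  · refine Or.inl ⟨φ, ?_⟩
    simp only [hφ]
    exact hf.rescale_reparam b.2 φ
  · refine Or.inr ⟨fun t => rescale f m (γ t), hf.isPlot_rescale hγ fun t _ => hM t,
      fun t => hf.rescale_mem (hM t), fun t => ?_, by simp only [h0], by simp only [h1]⟩
    obtain ⟨h, hh, hv⟩ := hv t
    obtain ⟨r, s, rfl⟩ := Submodule.mem_span_pair.1 hh
    refine ⟨_, ?_, hf.isVelocity_rescale hγ (fun t _ => hM t) (mem_univ t) hv⟩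
    have hl := hf.smooth.dirDeriv_linear (hM t)
    have hp := (hf.pos _ (hM t)).ne'
    have hm := hf.degree_ne
    have h2 : r • scalingField (γ t) + s • X (γ t) -
        (dirDeriv f (γ t) (r • scalingField (γ t) + s • X (γ t)) / (m * f (γ t))) • γ t =
          s • levelProj f m X (γ t) := by
      rw [hl.map_add, hl.map_smul, hl.map_smul, scalingField, hf.euler _ (hM t), levelProj,
        smul_eq_mul, smul_eq_mul, add_div, mul_div_cancel_right₀ _ (mul_ne_zero hm hp)]
      module
    set σ := -(Real.log (f (γ t)) / m) with hσ
    have h3 : levelProj f m X (γ t) = Real.exp (-(n * σ)) • Z (rescale f m (γ t)) := by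
      rw [hZ _ (hf.rescale_mem (hM t)).1, rescale, hf.levelProj_exp_smul hX (hM t), smul_smul,
        ← Real.exp_add, neg_add_cancel, Real.exp_zero, one_smul]
    rw [h2, h3]
    exact Submodule.smul_mem _ _ (Submodule.smul_mem _ _ (Submodule.smul_mem _ _
      (Submodule.mem_span_singleton_self _)))

theorem leafStep_exp_smul (X : Loop → Loop) {c : Loop} (hc : c ∈ Imm) (s : ℝ) :
    leafStep Imm (scalingDist X) ⟨Real.exp s • c, exp_smul_mem_imm hc s⟩ ⟨c, hc⟩ := by
  refine Or.inr ⟨fun t => Real.exp (t * -s) • (Real.exp s • c), isPlot_exp_smul _ _,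
    fun t => exp_smul_mem_imm (exp_smul_mem_imm hc s) _, fun t => ⟨_, ?_, isVelocity_exp_smul _ _ t⟩,
    by simp, ?_⟩
  · exact Submodule.smul_mem _ _ (Submodule.subset_span (by simp [scalingField]))
  · simp only
    rw [smul_smul, ← Real.exp_add]
    simp

/-- The level set of a homogeneous function is a slice for the scaling action: its leaf space is the
leaf space of all immersions. -/
theorem IsHomogeneousFun.inclusionIdentifies (hf : IsHomogeneousFun f m)
    (hZ : ∀ c ∈ Imm, Z c = levelProj f m X c)
    (hX : ∀ c ∈ Imm, ∀ t : ℝ, X (Real.exp t • c) = Real.exp (n * t) • X c) :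
    InclusionIdentifies (levelOne f) (lineDist Z) Imm (scalingDist X) := by
  have hM : levelOne f ⊆ Imm := fun _ hc => hc.1
  refine ⟨hM, ?_, fun c hc => ⟨?_, hf.tangentSpace_inf hZ hc⟩⟩
  -- The inverse is induced by `rescale`: it fixes the level set, and it moves any other curve along
  -- its scaling orbit, hence within its leaf.
  · let e : LeafSpace (levelOne f) (lineDist Z) ≃ LeafSpace Imm (scalingDist X) :=
      { toFun := Quot.map (fun c => ⟨c.1, hM c.2⟩) fun b c h => leafStep_inclusion hZ h
        invFun := Quot.map (fun c => ⟨rescale f m c.1, hf.rescale_mem c.2⟩)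
          fun b c h => hf.leafStep_rescale hZ hX h
        left_inv := by
          rintro ⟨c⟩
          exact congrArg (Quot.mk _) (Subtype.ext (rescale_eq_self c.2.2))
        right_inv := by
          rintro ⟨c⟩
          exact Quot.sound (leafStep_exp_smul X c.2 _) }
    refine ⟨e, fun k U p hp => ⟨hp.1, fun x hx => ?_⟩, fun k U p hp => ⟨hp.1, fun x hx => ?_⟩,
      fun c => rfl⟩
    · obtain ⟨V, γ, hγ, hxV, hVU, hlift⟩ := hp.2 x hx
      exact ⟨V, γ, ⟨hγ.1, fun y hy => hM (hγ.2 y hy)⟩, hxV, hVU,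
        fun y hy => congrArg e (hlift y hy)⟩
    · obtain ⟨V, γ, hγ, hxV, hVU, hlift⟩ := hp.2 x hx
      exact ⟨V, fun y => rescale f m (γ y), ⟨hf.isPlot_rescale hγ.1 hγ.2,
        fun y hy => hf.rescale_mem (hγ.2 y hy)⟩, hxV, hVU, fun y hy => congrArg e.symm (hlift y hy)⟩
  · rw [hf.tangentSpace_sup hc, tangentSpace_imm hc.1]

/-- A closed two-form whose kernel is spanned by the vertical space, the scaling field and `X`
induces a non-degenerate form on the leaf space of the level set of a homogeneous function. -/
theorem IsHomogeneousFun.exists_quotientForm (hf : IsHomogeneousFun f m)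
    (hZ : ∀ c ∈ Imm, Z c = levelProj f m X c) {Ω : Loop → Loop → Loop → ℝ}
    (hΩ : IsSmoothTwoForm Ω) (hcl : IsClosedTwoForm Ω)
    (hinv : ∀ c ∈ Imm, ∀ (φ : DiffPlus) (h k : Loop),
      Ω (reparam φ c) (reparam φ h) (reparam φ k) = Ω c h k)
    (hker : ∀ c ∈ Imm, ∀ h, h ∈ fibreTangent (scalingDist X) c ↔ ∀ k, Ω c h k = 0) :
    ∃ η : QuotientForm (levelOne f) (lineDist Z), Induces Ω η ∧ ∀ c, η.NondegenerateAt c := by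
  have hM : levelOne f ⊆ Imm := fun _ hc => hc.1
  obtain ⟨η, hη⟩ := SpaceCurve.exists_quotientForm hΩ hM hinv (fun c hc => hf.fibreTangent_le hZ hc)
    fun c hc h hh => (hker c hc.1 h).1
      (sup_le_sup le_rfl (lineDist_le_scalingDist hZ hc.1) hh)
  refine ⟨η, ⟨hη, fun Y hY hYD c hc h _ k _ => hΩ.lieDeriv_eq_zero hcl hY (fun b hb => ?_) hc.1 h k⟩,
    fun c => QuotientForm.nondegenerateAt_of hη fun h hh hk => ?_⟩
  · exact (hker b hb _).1 (Submodule.mem_sup_right (lineDist_le_scalingDist hZ hb (hYD b hb)))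
  · rw [← hf.tangentSpace_inf hZ c.2]
    refine ⟨hh, (hker c.1 c.2.1 h).2 fun k => ?_⟩
    have h1 : ∀ k, Ω c.1 c.1 k = 0 := (hker c.1 c.2.1 c.1).1
      (mem_fibreTangent_scalingDist.2 ⟨0, Submodule.zero_mem _, 1, 0, by simp⟩)
    -- Any k is tangent to the level set up to a multiple of c, and c is in the kernel, so testing
    -- on tangent vectors suffices.
    have h2 := hk _ (hf.exists_tangent_add_smul c.2 k)
    have hl := (hΩ.1 c.1 c.2.1).2.1 h
    rwa [hl.map_sub, hl.map_smul, hΩ.swap c.2.1 h c.1, h1, neg_zero, smul_zero, sub_zero] at h2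

end Slice

/-! ### The scale-invariant case -/

/-- A positive, reparametrization invariant smooth function `lam` with `3 lam + D_{c,c} lam = 0`,
together with its smooth horizontal gradient `X`. -/
structure IsScaleInvariantPair (lam : Loop → ℝ) (X : Loop → Loop) : Prop where
  pos : ∀ c ∈ Imm, 0 < lam c
  smooth : IsSmoothFun lam
  inv : ∀ c ∈ Imm, ∀ φ : DiffPlus, lam (reparam φ c) = lam c
  defect : ∀ c ∈ Imm, scaleDefect lam c = 0
  grad : IsHorizontalGradient lam X
  smoothField : IsSmoothField X

namespace IsScaleInvariantPair

variable {lam : Loop → ℝ} {X : Loop → Loop}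

theorem isHomogeneousFun (H : IsScaleInvariantPair lam X) : IsHomogeneousFun lam (-3) where
  smooth := H.smooth
  pos := H.pos
  inv := H.inv
  degree_ne := by norm_num
  euler c hc := by
    have := H.defect c hc
    rw [scaleDefect] at this
    linarith

theorem dirDeriv_eq (H : IsScaleInvariantPair lam X) {c : Loop} (hc : c ∈ Imm) (k : Loop) :
    dirDeriv lam c k = 3 * tripleInt (derivLoop c) (X c) k := by
  rw [(H.grad c hc).1 k, inducedForm_id]

theorem dirDeriv_field (H : IsScaleInvariantPair lam X) {c : Loop} (hc : c ∈ Imm) :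
    dirDeriv lam c (X c) = 0 := by
  rw [H.dirDeriv_eq hc, tripleInt_self_right, mul_zero]

/-- The gradient equation evaluated at c, combined with dλ(c) = -3λ. -/
theorem tripleInt_field_self (H : IsScaleInvariantPair lam X) {c : Loop} (hc : c ∈ Imm) :
    tripleInt (derivLoop c) (X c) c = - lam c := by
  have h1 := H.isHomogeneousFun.euler c hc
  rw [H.dirDeriv_eq hc] at h1
  linarith

theorem inducedForm_self_left (H : IsScaleInvariantPair lam X) {c : Loop} (hc : c ∈ Imm)
    (k : Loop) : inducedForm (conformal lam) c c k = 0 := by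
  rw [(isSmoothTwoForm_inducedForm H.smooth).swap hc, inducedForm_self_right H.smooth hc,
    H.defect c hc, zero_mul, neg_zero]

/-- Since dλ(X) = 0 and T(c', X, c) = -λ, the two remaining terms are λ dλ(k) and -λ dλ(k). -/
theorem inducedForm_field (H : IsScaleInvariantPair lam X) {c : Loop} (hc : c ∈ Imm)
    (k : Loop) : inducedForm (conformal lam) c (X c) k = 0 := by
  rw [inducedForm_conformal H.smooth hc, H.tripleInt_field_self hc, H.dirDeriv_field hc,
    H.dirDeriv_eq hc]
  ring

/-- The kernel of `Ω^λ` is spanned by the vertical space, the scaling field, and `X`. -/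
theorem mem_fibreTangent_iff (H : IsScaleInvariantPair lam X) {c : Loop} (hc : c ∈ Imm) (h : Loop) :
    h ∈ fibreTangent (scalingDist X) c ↔ ∀ k, inducedForm (conformal lam) c h k = 0 := by
  have hΩ := isSmoothTwoForm_inducedForm H.smooth
  constructor
  · intro hh k
    obtain ⟨v, hv, r, s, rfl⟩ := mem_fibreTangent_scalingDist.1 hh
    have hl := (hΩ.1 c hc).1 k
    rw [hl.map_add, hl.map_add, hl.map_smul, hl.map_smul, H.inducedForm_self_left hc,
      H.inducedForm_field hc, inducedForm_vert H.smooth H.inv hc hv]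
    simp
  · intro hh
    -- Substituting dλ(w) = 3 T(c', X, w) puts every term of the kernel equation in the form T(c',
    -- ·, w), so the combined vector is vertical; dividing by 3λ solves for h.
    have hv : (3 * lam c) • h + ((3 * tripleInt (derivLoop c) h c) • X c +
        dirDeriv lam c h • c) ∈ vert c := by
      refine mem_vert_of_cross_eq_zero hc
        (cross_eq_zero_of_tripleInt (u := derivLoop c) fun w => ?_)
      have h2 := hh w
      rw [inducedForm_conformal H.smooth hc, H.dirDeriv_eq hc w] at h2
      have h3 : tripleInt (derivLoop c) c w = - tripleInt (derivLoop c) w c := by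
        rw [tripleInt_rotate, tripleInt_swap, ← tripleInt_rotate (derivLoop c) w c]
      rw [tripleInt_add_mid, tripleInt_add_mid, tripleInt_smul_mid, tripleInt_smul_mid,
        tripleInt_smul_mid, h3]
      linarith
    have h4 := (H.pos c hc).ne'
    have h5 : (3 * lam c) ≠ 0 := mul_ne_zero three_ne_zero h4
    refine mem_fibreTangent_scalingDist.2 ⟨_, (vert c).smul_mem (3 * lam c)⁻¹ hv,
      -((3 * lam c)⁻¹ * dirDeriv lam c h), -((3 * lam c)⁻¹ * (3 * tripleInt (derivLoop c) h c)), ?_⟩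
    rw [smul_add, smul_smul, inv_mul_cancel₀ h5, one_smul]
    module

/-- The functionals T(c', ·, c) and dλ vanish on vertical vectors; on r c + s X they take the values
-sλ and -3rλ. -/
theorem eq_zero_of_mem_vert (H : IsScaleInvariantPair lam X) {c : Loop} (hc : c ∈ Imm) {r s : ℝ}
    (hv : r • c + s • X c ∈ vert c) : r = 0 ∧ s = 0 := by
  have h0 := (H.pos c hc).ne'
  have hl := H.smooth.dirDeriv_linear hc
  have h1 := tripleInt_vert hv c
  rw [tripleInt_add_mid, tripleInt_smul_mid, tripleInt_smul_mid, tripleInt_self_right,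
    H.tripleInt_field_self hc] at h1
  have h2 := dirDeriv_vert H.smooth H.inv hc hv
  rw [hl.map_add, hl.map_smul, hl.map_smul, H.dirDeriv_field hc,
    H.isHomogeneousFun.euler c hc] at h2
  simp only [smul_eq_mul, mul_zero, add_zero, zero_add, mul_neg, neg_eq_zero, neg_mul, mul_eq_zero,
    OfNat.ofNat_ne_zero, h0, or_false] at h1 h2
  exact ⟨h2, h1⟩

/-- The horizontal gradient is homogeneous of degree `-5`. -/
theorem field_exp_smul (H : IsScaleInvariantPair lam X) {c : Loop} (hc : c ∈ Imm) (t : ℝ) :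
    X (Real.exp t • c) = Real.exp (-5 * t) • X c := by
  have hct := exp_smul_mem_imm hc t
  have hd : ∀ θ, deriv (Real.exp t • c).1 θ = Real.exp t • deriv c.1 θ := fun θ => by
    rw [← derivLoop_apply, map_smul, Loop.smul_apply, derivLoop_apply]
  -- Horizontality of X at both curves removes the component of the difference along c'.
  have ho : ∀ θ, inner ℝ (deriv c.1 θ) ((X (Real.exp t • c) - Real.exp (-5 * t) • X c).1 θ) = 0 := by
    intro θ
    have h1 := inner_deriv_eq_zero_of_metric hct (H.grad _ hct).2 θ
    have h2 := inner_deriv_eq_zero_of_metric hc (H.grad _ hc).2 θ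
    rw [hd, real_inner_smul_right] at h1
    have h3 := (mul_eq_zero.1 h1).resolve_left (Real.exp_pos t).ne'
    rw [Loop.sub_apply, Loop.smul_apply, inner_sub_right, real_inner_smul_right, real_inner_comm,
      h3, real_inner_comm, h2]
    simp
  -- For the normal component: dλ has degree -4 and T(c', ·, ·) has degree 1, which leaves -5 for X.
  have hx : ∀ θ, cross (deriv c.1 θ) ((X (Real.exp t • c) - Real.exp (-5 * t) • X c).1 θ) = 0 := by
    refine cross_eq_zero_of_tripleInt (u := derivLoop c) fun w => ?_
    have h1 := H.isHomogeneousFun.dirDeriv_exp_smul hc t w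
    rw [H.dirDeriv_eq hct, H.dirDeriv_eq hc, map_smul, tripleInt_smul_left] at h1
    have h2 : Real.exp ((-3 - 1) * t) = Real.exp t * Real.exp (-5 * t) := by
      rw [← Real.exp_add]
      ring_nf
    rw [h2] at h1
    have h3 : tripleInt (derivLoop c) (X (Real.exp t • c)) w =
        Real.exp (-5 * t) * tripleInt (derivLoop c) (X c) w :=
      mul_left_cancel₀ (Real.exp_pos t).ne' (by linarith)
    rw [sub_eq_add_neg, ← neg_smul, tripleInt_add_mid, tripleInt_smul_mid, h3]
    ring
  refine sub_eq_zero.1 (Loop.ext' fun θ => ?_)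
  rw [eq_smul_of_cross_eq_zero (hc θ) (hx θ), ho θ, zero_div, zero_smul]
  rfl

/-- D_c X = -5X by homogeneity and D_X I = X, so the bracket is -5X - X. -/
theorem bracket_scalingField (H : IsScaleInvariantPair lam X) {c : Loop} (hc : c ∈ Imm) :
    bracket scalingField X c = (-6 : ℝ) • X c := by
  have h1 : fieldDeriv scalingField c (X c) = X c := by
    rw [fieldDeriv, ← toLoop_coe (X c)]
    congr 1
    funext θ
    rw [toLoop_coe]
    exact (isVelocity_line c (X c) 0 θ).deriv
  have h2 : fieldDeriv X c c = (-5 : ℝ) • X c := by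
    refine (H.smoothField.isVelocity_line hc c).unique fun θ => ?_
    have h3 : HasDerivAt (fun t : ℝ => Real.exp (-5 * Real.log (1 + t))) (-5) 0 := by
      have := ((((hasDerivAt_id (0 : ℝ)).const_add 1).log (by simp)).const_mul (-5)).exp
      simpa using this
    refine (h3.smul_const ((X c).1 θ)).congr_of_eventuallyEq ?_
    filter_upwards [Ioi_mem_nhds (show (-1 : ℝ) < 0 by norm_num)] with t ht
    have h4 : (0 : ℝ) < 1 + t := by linarith [mem_Ioi.1 ht]
    have h5 : c + t • c = Real.exp (Real.log (1 + t)) • c := by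
      rw [Real.exp_log h4]
      module
    rw [h5, H.field_exp_smul hc]
    rfl
  rw [bracket, scalingField, h2, h1]
  module

/-- As dλ(X) = 0, the field X is already tangent to the level sets of λ, so the slice results apply
to it unprojected. -/
theorem eq_levelProj (H : IsScaleInvariantPair lam X) {c : Loop} (hc : c ∈ Imm) :
    X c = levelProj lam (-3) X c := by
  rw [levelProj, H.dirDeriv_field hc]
  simp

theorem exists_quotientForm (H : IsScaleInvariantPair lam X) :
    ∃ η : QuotientForm Imm (scalingDist X),
      Induces (inducedForm (conformal lam)) η ∧ ∀ c, η.NondegenerateAt c := by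
  have hΩ := isSmoothTwoForm_inducedForm H.smooth
  obtain ⟨η, hη⟩ := SpaceCurve.exists_quotientForm (D := scalingDist X) hΩ le_rfl
    (fun c hc => inducedForm_reparam H.smooth H.inv hc)
    (fun c hc => by rw [tangentSpace_imm hc]; exact le_top)
    fun c hc h hh => (H.mem_fibreTangent_iff hc h).1 hh
  refine ⟨η, ⟨hη, fun Y hY hYD c hc h _ k _ => hΩ.lieDeriv_eq_zero
    (isClosedTwoForm_inducedForm H.smooth) hY (fun b hb => ?_) hc h k⟩,
    fun c => QuotientForm.nondegenerateAt_of hη fun h _ hk => ?_⟩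
  · exact (H.mem_fibreTangent_iff hb _).1 (Submodule.mem_sup_right (hYD b hb))
  · refine (H.mem_fibreTangent_iff c.2 h).2 fun k => hk k ?_
    rw [tangentSpace_imm c.2]
    trivial

theorem exists_quotientForm_level (H : IsScaleInvariantPair lam X) {f : Loop → ℝ} {m : ℝ}
    (hf : IsHomogeneousFun f m) {Z : Loop → Loop} (hZ : ∀ c ∈ Imm, Z c = levelProj f m X c) :
    ∃ η : QuotientForm (levelOne f) (lineDist Z),
      Induces (inducedForm (conformal lam)) η ∧ ∀ c, η.NondegenerateAt c :=
  hf.exists_quotientForm hZ (isSmoothTwoForm_inducedForm H.smooth)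
    (isClosedTwoForm_inducedForm H.smooth) (fun _ hc => inducedForm_reparam H.smooth H.inv hc)
    fun _ hc => H.mem_fibreTangent_iff hc

theorem inducedForm_levelOne (H : IsScaleInvariantPair lam X) {c : Loop} (hc : c ∈ levelOne lam)
    {h k : Loop} (hh : h ∈ tangentSpace (levelOne lam) c)
    (hk : k ∈ tangentSpace (levelOne lam) c) :
    inducedForm (conformal lam) c h k = 3 * marsdenWeinstein c h k := by
  rw [inducedForm_conformal H.smooth hc.1, marsdenWeinstein_eq, hc.2,
    (H.isHomogeneousFun.mem_tangentSpace_iff hc).1 hh,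
    (H.isHomogeneousFun.mem_tangentSpace_iff hc).1 hk]
  ring

end IsScaleInvariantPair

/-! ### The form on shape space -/

theorem exists_quotientForm_shapeSpace {lam : Loop → ℝ} (hpos : ∀ c ∈ Imm, 0 < lam c)
    (hs : IsSmoothFun lam) (hinv : ∀ c ∈ Imm, ∀ φ : DiffPlus, lam (reparam φ c) = lam c) :
    ∃ η : QuotientForm Imm noDist, Induces (inducedForm (conformal lam)) η ∧
      ∀ c : Imm, scaleDefect lam c.1 ≠ 0 → η.NondegenerateAt c := by
  have hΩ := isSmoothTwoForm_inducedForm hs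
  have hfib : ∀ c, fibreTangent noDist c = vert c := fun c => sup_bot_eq _
  obtain ⟨η, hη⟩ := exists_quotientForm (D := noDist) hΩ le_rfl
    (fun c hc => inducedForm_reparam hs hinv hc)
    (fun c hc => by rw [tangentSpace_imm hc]; exact le_top)
    fun c hc h hh => inducedForm_vert hs hinv hc (hfib c ▸ hh)
  refine ⟨η, ⟨hη, fun Y hY hYD c hc h _ k _ => hΩ.lieDeriv_eq_zero
    (isClosedTwoForm_inducedForm hs) hY (fun b hb k => ?_) hc h k⟩,
    fun c hdef => QuotientForm.nondegenerateAt_of hη fun h _ hk => ?_⟩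
  · rw [(Submodule.mem_bot ℝ).1 (hYD b hb), ((hΩ.1 b hb).1 k).map_zero]
  · rw [hfib]
    refine mem_vert_of_inducedForm_eq_zero hpos hs hinv c.2 hdef fun k => hk k ?_
    rw [tangentSpace_imm c.2]
    trivial

end SpaceCurve

/-! ### The theorem. -/

open SpaceCurve

theorem theorem3p2 (lam : Loop → ℝ)
    (hpos : ∀ c ∈ Imm, 0 < lam c)
    (hsmooth : IsSmoothFun lam)
    (hinv : ∀ c ∈ Imm, ∀ φ : DiffPlus, lam (reparam φ c) = lam c) :
    -- the (pre)symplectic form on parametrized curves and its formula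
    (IsSmoothOneForm (liouville (conformal lam)) ∧
      IsSmoothTwoForm (inducedForm (conformal lam)) ∧
      IsClosedTwoForm (inducedForm (conformal lam)) ∧
      ∀ c ∈ Imm, ∀ h k : Loop, inducedForm (conformal lam) c h k =
        lam c * inducedForm idOp c h k + wedge (liouville idOp) (dirDeriv lam) c h k) ∧
    -- (a) the form on shape space, and its non-degeneracy
    (∃ η : QuotientForm Imm noDist, Induces (inducedForm (conformal lam)) η ∧
      (∀ c : Imm, scaleDefect lam c.1 ≠ 0 → η.NondegenerateAt c) ∧
      ((∀ V : Set Loop, IsOpenInImm V → V.Nonempty → ∃ c ∈ V, scaleDefect lam c ≠ 0) →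
        (∃ W : Set Loop, IsOpenInImm W ∧ (∀ V : Set Loop, IsOpenInImm V → V.Nonempty →
          (V ∩ W).Nonempty) ∧ ∀ c : Imm, c.1 ∈ W → η.NondegenerateAt c) ∧
        ∀ Y : Loop → Loop, IsSmoothField Y →
          (∀ c ∈ Imm, ∀ k : Loop, inducedForm (conformal lam) c (Y c) k = 0) →
          ∀ c ∈ Imm, Y c ∈ vert c)) ∧
    -- (b) the scale-invariant case
    ((∀ c ∈ Imm, scaleDefect lam c = 0) →
      ∀ X : Loop → Loop, IsHorizontalGradient lam X → IsSmoothField X →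
        -- the scaling field and `X` lie in the kernel, and span an involutive distribution
        -- of dimension two, also modulo the vertical space
        (∀ c ∈ Imm,
          (∀ k : Loop, inducedForm (conformal lam) c (scalingField c) k = 0 ∧
            inducedForm (conformal lam) c (X c) k = 0) ∧
          (∀ r s : ℝ, r • scalingField c + s • X c ∈ vert c → r = 0 ∧ s = 0) ∧
          bracket scalingField X c ∈ scalingDist X c) ∧
        -- the form on the quotient by the distribution is non-degenerate
        (∃ η : QuotientForm Imm (scalingDist X),
          Induces (inducedForm (conformal lam)) η ∧ ∀ c, η.NondegenerateAt c) ∧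
        -- this quotient is the quotient of the level set of `lam`, where the form is a multiple
        -- of the Marsden-Weinstein form
        InclusionIdentifies (levelOne lam) (lineDist X) Imm (scalingDist X) ∧
        (∃ η : QuotientForm (levelOne lam) (lineDist X),
          Induces (inducedForm (conformal lam)) η ∧ (∀ c, η.NondegenerateAt c) ∧
          ∀ (c : levelOne lam) (h k : tangentSpace (levelOne lam) c.1),
            η.form c (tangentClass _ _ c.1 h) (tangentClass _ _ c.1 k) =
              3 * marsdenWeinstein c.1 h.1 k.1) ∧
        -- the same for the curves of unit length
        InclusionIdentifies (levelOne length) (lineDist (lengthProj X)) Imm (scalingDist X) ∧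
        (∃ η : QuotientForm (levelOne length) (lineDist (lengthProj X)),
          Induces (inducedForm (conformal lam)) η ∧ ∀ c, η.NondegenerateAt c)) := by
  refine ⟨⟨isSmoothOneForm_liouville_conformal hsmooth, isSmoothTwoForm_inducedForm hsmooth,
    isClosedTwoForm_inducedForm hsmooth,
    fun c hc h k => inducedForm_conformal_eq_wedge hsmooth hc h k⟩, ?_, ?_⟩
  · obtain ⟨η, hη, hnd⟩ := exists_quotientForm_shapeSpace hpos hsmooth hinv
    -- The open dense set is the locus where 3λ + D_{c,c}λ ≠ 0.
    refine ⟨η, hη, hnd, fun hdense => ⟨⟨{c | c ∈ Imm ∧ scaleDefect lam c ≠ 0},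
      isOpenInImm_ne (isSmoothFun_scaleDefect hsmooth), fun V hV hne => ?_,
      fun c hc => hnd c hc.2⟩, fun Y hY hker c hc => ?_⟩⟩
    · obtain ⟨c, hcV, hc⟩ := hdense V hV hne
      exact ⟨c, hcV, hV.1 hcV, hc⟩
    · refine hY.mem_vert_of_dense (fun V hV hne => ?_) hc
      obtain ⟨b, hbV, hb⟩ := hdense V hV hne
      exact ⟨b, hbV, mem_vert_of_inducedForm_eq_zero hpos hsmooth hinv (hV.1 hbV) hb
        (hker b (hV.1 hbV))⟩
  · intro hdef X hgrad hX
    have H : IsScaleInvariantPair lam X := ⟨hpos, hsmooth, hinv, hdef, hgrad, hX⟩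
    have hZ : ∀ c ∈ Imm, lengthProj X c = levelProj length 1 X c := fun c _ => by
      rw [lengthProj, levelProj, one_mul, scalingField]
    refine ⟨fun c hc => ⟨fun k => ⟨H.inducedForm_self_left hc k, H.inducedForm_field hc k⟩,
      fun r s hv => H.eq_zero_of_mem_vert hc hv, ?_⟩, H.exists_quotientForm,
      H.isHomogeneousFun.inclusionIdentifies (fun c hc => H.eq_levelProj hc)
        (fun c hc => H.field_exp_smul hc), ?_,
      isHomogeneousFun_length.inclusionIdentifies hZ (fun c hc => H.field_exp_smul hc),
      H.exists_quotientForm_level isHomogeneousFun_length hZ⟩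
    · rw [H.bracket_scalingField hc]
      exact Submodule.smul_mem _ _ (Submodule.subset_span (by simp))
    · obtain ⟨η, hη, hnd⟩ := H.exists_quotientForm_level H.isHomogeneousFun
        fun c hc => H.eq_levelProj hc
      exact ⟨η, hη, hnd, fun c h k => (hη.1 c h k).trans (H.inducedForm_levelOne c.2 h.2 k.2)⟩
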